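/- Let $(\Omega,\mathcal F,P)$ be a probability space and, for each $n\ge1$, let $\mathcal C_n\subseteq\mathcal F$ be a sub-$\sigma$-field and $e_{1,n},\dots,e_{n,n}$ random vectors in $\mathbb R^{d}$ ($d$ fixed) that are mutually conditionally independent given $\mathcal C_n$. For each $i$ let $e_{i,n}^*$ be a random vector with the same conditional distribution given $\mathcal C_n$ as $e_{i,n}$ and such that $e_{1,n},\dots,e_{n,n},e_{i,n}^*$ are mutually conditionally independent given $\mathcal C_n$. Let $F_{j,n}:(\mathbb R^{d})^n\to\mathbb R$ be measurable ($1\le j\le n$) and put $$Y_{j,n}=F_{j,n}(e_{1,n},\dots,e_{n,n}),\qquad Y_{j,n,i}=F_{j,n}(e_{1,n},\dots,e_{i-1,n},e_{i,n}^*,e_{i+1,n},\dots,e_{n,n}),$$ $$\delta_{p,n}(j,i,\mathcal C_n)=\bigl(\mathbb E[|Y_{j,n}-Y_{j,n,i}|^p\mid\mathcal C_n]\bigr)^{1/p}\in[0,\infty],\qquad \Delta_{p,2}(\mathcal C_n)=\frac1{n^2}\sum_{i=1}^n\Bigl[\sum_{j=1}^n\delta_{p,n}(j,i,\mathcal C_n)\Bigr]^2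 .$$ **Theorem.** There is a function $\alpha\mapsto c_\alpha\in\mathbb R$ such that the following holds in every setting as above. Suppose that each $Y_{j,n}$ is integrable with $\mathbb E[Y_{j,n}\mid\mathcal C_n]=0$ a.s., and that for some constants $\nu\ge0$ and $0<\gamma_0<\infty$ $$\sup_{p\ge2}\ \sup_{n\ge1}\ p^{-\nu}\sqrt n\,\Delta_{p,2}^{1/2}(\mathcal C_n)\le\gamma_0\quad\text{a.s.},$$ in the sense that for every real $p\ge2$ and every $n\ge1$ one has $p^{-\nu}\sqrt n\,\Delta_{p,2}^{1/2}(\mathcal C_n)\le\gamma_0$ a.s. Let $Z_n=n^{-1/2}\sum_{j=1}^nY_{j,n}$, $\alpha=\frac{2}{1+2\nu}$ and $t_0=(e\alpha\gamma_0^\alpha)^{-1}$. Then, for every $n\ge1$: 1. for every $t\in[0,t_0)$ the variable $\exp(t|Z_n|^\alpha)$ is integrable, and $$m(t):=\mathbb E\bigl[\exp(t|Z_n|^\alpha)\mid\mathcal C_n\bigr]\le1+c_\alpha\Bigl(1-\frac t{t_0}\Bigr)^{-1/2}\frac t{t_0}\quad\text{a.s.};$$ 2. for every $x>0$, $$P\bigl(|Z_n|\ge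 x\mid\mathcal C_n\bigr)\le e^{-\frac{t_0}{2}x^\alpha}\,m\Bigl(\frac{t_0}{2}\Bigr)\le\Bigl(1+\frac{\sqrt2\,c_\alpha}{2}\Bigr)\exp\Bigl(-\frac{x^\alpha}{2e\alpha\gamma_0^\alpha}\Bigr)\quad\text{a.s.}$$ -/

import Mathlib

open MeasureTheory ProbabilityTheory
open scoped ENNReal

noncomputable section

/-- Mutual conditional independence, given the sub-`σ`-field `m`, of a family of random elements,
on an arbitrary probability space: conditional probabilities of finite intersections of events
`{f i ∈ B i}` factorize almost surely. (On standard Borel spaces this is Mathlib's `iCondIndepFun`,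
which is only available there.) -/
def CondIndepFamily {Ω ι E : Type*} [MeasurableSpace E] (m : MeasurableSpace Ω)
    {mΩ : MeasurableSpace Ω} (μ : Measure Ω) (f : ι → Ω → E) : Prop :=
  ∀ (S : Finset ι) (B : ι → Set E), (∀ i ∈ S, MeasurableSet (B i)) →
    μ⟦⋂ i ∈ S, f i ⁻¹' B i | m⟧ =ᵐ[μ] ∏ i ∈ S, μ⟦f i ⁻¹' B i | m⟧

/-- `X` and `Y` have the same conditional distribution given the sub-`σ`-field `m`. -/
def CondIdentDistrib {Ω E : Type*} [MeasurableSpace E] (m : MeasurableSpace Ω)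
    {mΩ : MeasurableSpace Ω} (μ : Measure Ω) (X Y : Ω → E) : Prop :=
  ∀ B : Set E, MeasurableSet B → μ⟦X ⁻¹' B | m⟧ =ᵐ[μ] μ⟦Y ⁻¹' B | m⟧

/-- `e'` consists of conditionally i.i.d. copies of the members of `e` given `m`: for each `i`,
`e' i` has the conditional distribution of `e i`, and is conditionally independent of the whole
family `e`, whose members are themselves conditionally independent: `(e 1, …, e n, e' i)` is a
mutually conditionally independent family. -/
def IsCondIndepCopy {Ω E : Type*} [MeasurableSpace E] (m : MeasurableSpace Ω)
    {mΩ : MeasurableSpace Ω} (μ : Measure Ω) {n : ℕ} (e e' : Fin n → Ω → E) : Prop :=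
  ∀ i : Fin n, CondIdentDistrib m μ (e' i) (e i) ∧
    CondIndepFamily m μ (fun o : Option (Fin n) => o.elim (e' i) e)

/-- The random variables `Y j = F j (e 1, …, e n)`. -/
def networkVar {Ω E : Type*} {n : ℕ} (F : Fin n → (Fin n → E) → ℝ) (e : Fin n → Ω → E)
    (j : Fin n) (ω : Ω) : ℝ :=
  F j (fun k => e k ω)

/-- The coupled version of `Y j`, with `e i` replaced by its copy `e' i`. -/
def coupledVar {Ω E : Type*} {n : ℕ} (F : Fin n → (Fin n → E) → ℝ) (e e' : Fin n → Ω → E)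
    (j i : Fin n) (ω : Ω) : ℝ :=
  F j (Function.update (fun k => e k ω) i (e' i ω))

/-- The conditional `L^p` norm `[E(|X|^p | m)]^{1/p}`, with values in `[0, ∞]`. -/
def condLpNorm {Ω : Type*} (m : MeasurableSpace Ω) {mΩ : MeasurableSpace Ω} (μ : Measure Ω)
    (p : ℝ) (X : Ω → ℝ) (ω : Ω) : ℝ≥0∞ :=
  (μ⁻[fun ω' => ‖X ω'‖ₑ ^ p | m] ω) ^ (1 / p)

/-- The functional dependence measure `δ_p(j, i, m)`. -/
def fdm {Ω E : Type*} (m : MeasurableSpace Ω) {mΩ : MeasurableSpace Ω} (μ : Measure Ω) {n : ℕ}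
    (F : Fin n → (Fin n → E) → ℝ) (e e' : Fin n → Ω → E) (p : ℝ) (j i : Fin n) : Ω → ℝ≥0∞ :=
  condLpNorm m μ p (fun ω => networkVar F e j ω - coupledVar F e e' j i ω)

/-- `Δ_{p,q}(m) = n^{-q} ∑_i [∑_j δ_p(j, i, m)]^q`. -/
def fdmDelta {Ω E : Type*} (m : MeasurableSpace Ω) {mΩ : MeasurableSpace Ω} (μ : Measure Ω)
    {n : ℕ} (F : Fin n → (Fin n → E) → ℝ) (e e' : Fin n → Ω → E) (p q : ℝ) (ω : Ω) : ℝ≥0∞ :=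
  (∑ i : Fin n, (∑ j : Fin n, fdm m μ F e e' p j i ω) ^ q) / (n : ℝ≥0∞) ^ q

/-- The normalized sum `Z = n^{-1/2} ∑_j Y j`. -/
def normalizedSum {Ω E : Type*} {n : ℕ} (F : Fin n → (Fin n → E) → ℝ) (e : Fin n → Ω → E)
    (ω : Ω) : ℝ :=
  (∑ j : Fin n, networkVar F e j ω) / √(n : ℝ)

/-- The threshold `t₀ = (e α γ₀^α)⁻¹`. -/
def expThreshold (α γ₀ : ℝ) : ℝ := (Real.exp 1 * α * γ₀ ^ α)⁻¹

/-- `m(t) = E[exp(t |Z|^α) | m]`. -/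
def condExpMoment {Ω : Type*} (m : MeasurableSpace Ω) {mΩ : MeasurableSpace Ω} (μ : Measure Ω)
    (α : ℝ) (Z : Ω → ℝ) (t : ℝ) : Ω → ℝ :=
  μ[fun ω => Real.exp (t * |Z ω| ^ α) | m]

end

-- Conditionally on `C n` the vectors `e i` are independent, so almost every `ω` gives a product
-- measure under which `Z` is a function of independent coordinates. Everything is proved for a
-- fixed product measure and transferred through regular conditional laws, which exist because the
-- `e i` take values in a standard Borel space.
--
-- The analytic core is an Efron–Stein inequality in `L^p`, `p ≥ 2`, with constant `p - 1`
-- (`lpNormSq_sub_integral_le_sum_resampleSq`). It rests on the sharp `2`-uniform smoothness of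
-- `L^p`: adding to `f` an increment `g` of zero conditional mean raises the squared norm by at most
-- `(p - 1) ‖g‖²`. Averaging out the coordinates one at a time writes `G - E G` as a sum of such
-- increments, each dominated through Jensen by the effect of resampling one coordinate. Minkowski
-- over `j` bounds these effects by the dependence measures, so the hypothesis becomes `‖Z‖_p² ≤ (p
-- - 1) (p ^ ν γ₀)²` under the conditional law (`ae_lpNormSq_condPiLaw_le`).
--
-- These moments have Weibull growth with `α (1 + 2 ν) = 2`. Expanding `exp (t |Z| ^ α)` in its
-- power series, taking `p = α k` in the `k`-th term and using Stirling bounds that term by a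
-- constant times `(t / t₀) ^ k / √k`. Summation gives the factor `(1 - t / t₀) ^ (-1 / 2)`, and a
-- conditional Chernoff bound at `t₀ / 2` gives the tail.

-- The sharp two-point inequality.

/-- The difference of the two sides vanishes at `0` and has derivative `m (m + 1) y ((1 + y) ^ (m -
1) - (1 - y) ^ (m - 1))`, nonnegative since `m ≥ 1`. -/
theorem one_add_rpow_sub_one_sub_rpow_le {m x : ℝ} (hm : 1 ≤ m) (hx0 : 0 ≤ x) (hx1 : x ≤ 1) :
    (1 + x) ^ m - (1 - x) ^ m ≤ m * x * ((1 + x) ^ m + (1 - x) ^ m) := by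
  let f : ℝ → ℝ := fun y => m * y * ((1 + y) ^ m + (1 - y) ^ m) - ((1 + y) ^ m - (1 - y) ^ m)
  have hm0 : 0 ≤ m := by linarith
  have hcont : ContinuousOn f (Set.Icc 0 1) := by
    have h1 : ContinuousOn (fun y : ℝ => (1 + y) ^ m) (Set.Icc 0 1) :=
      ContinuousOn.rpow_const (by fun_prop) fun _ _ => Or.inr hm0
    have h2 : ContinuousOn (fun y : ℝ => (1 - y) ^ m) (Set.Icc 0 1) :=
      ContinuousOn.rpow_const (by fun_prop) fun _ _ => Or.inr hm0
    exact ((continuousOn_const.mul continuousOn_id).mul (h1.add h2)).sub (h1.sub h2)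
  have hmono : MonotoneOn f (Set.Icc 0 1) := by
    refine monotoneOn_of_hasDerivWithinAt_nonneg (convex_Icc 0 1) hcont
      (f' := fun y => m * y * (m + 1) * ((1 + y) ^ (m - 1) - (1 - y) ^ (m - 1))) ?_ ?_
    · intro y hy
      rw [interior_Icc] at hy
      have hp : (0 : ℝ) < 1 + y := by linarith [hy.1]
      have hq : (0 : ℝ) < 1 - y := by linarith [hy.2]
      have d1 : HasDerivAt (fun y : ℝ => (1 + y) ^ m) (1 * m * (1 + y) ^ (m - 1)) y :=
        ((hasDerivAt_id y).const_add 1).rpow_const (Or.inr hm)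
      have d2 : HasDerivAt (fun y : ℝ => (1 - y) ^ m) (-1 * m * (1 - y) ^ (m - 1)) y :=
        ((hasDerivAt_id y).const_sub 1).rpow_const (Or.inr hm)
      have d3 : HasDerivAt (fun y : ℝ => m * y) (m * 1) y := (hasDerivAt_id y).const_mul m
      have e1 : (1 + y) ^ m = (1 + y) * (1 + y) ^ (m - 1) := by
        rw [Real.rpow_sub_one hp.ne']; field_simp
      have e2 : (1 - y) ^ m = (1 - y) * (1 - y) ^ (m - 1) := by
        rw [Real.rpow_sub_one hq.ne']; field_simp
      have := (d3.mul (d1.add d2)).sub (d1.sub d2)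
      refine HasDerivAt.hasDerivWithinAt (this.congr_deriv ?_)
      simp only [Pi.add_apply]
      rw [e1, e2]
      ring
    · intro y hy
      rw [interior_Icc] at hy
      have : (1 - y) ^ (m - 1) ≤ (1 + y) ^ (m - 1) :=
        Real.rpow_le_rpow (by linarith [hy.2]) (by linarith [hy.1]) (by linarith)
      have h0 : 0 ≤ m * y * (m + 1) := by have := hy.1; positivity
      exact mul_nonneg h0 (by linarith)
  have h0 : f 0 ≤ f x := hmono ⟨le_rfl, zero_le_one⟩ ⟨hx0, hx1⟩ hx0
  simp only [f, add_zero, sub_zero, mul_zero, zero_mul, sub_self] at h0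
  linarith

/-- The ratio of `(1 + y) ^ p + (1 - y) ^ p` to `(1 + (p - 1) y²) ^ (p / 2)` equals `2` at `0` and
decreases: the sign of its derivative is that of the preceding inequality with `m = p - 1`. -/
theorem one_add_rpow_add_one_sub_rpow_le {p x : ℝ} (hp : 2 ≤ p) (hx0 : 0 ≤ x) (hx1 : x ≤ 1) :
    (1 + x) ^ p + (1 - x) ^ p ≤ 2 * (1 + (p - 1) * x ^ 2) ^ (p / 2) := by
  let f : ℝ → ℝ := fun y => ((1 + y) ^ p + (1 - y) ^ p) * (1 + (p - 1) * y ^ 2) ^ (-(p / 2))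
  have hp0 : 0 ≤ p := by linarith
  have hpos : ∀ y : ℝ, 0 < 1 + (p - 1) * y ^ 2 := fun y => by
    have : 0 ≤ (p - 1) * y ^ 2 := mul_nonneg (by linarith) (sq_nonneg y)
    linarith
  have hcont : ContinuousOn f (Set.Icc 0 1) := by
    have h1 : ContinuousOn (fun y : ℝ => (1 + y) ^ p) (Set.Icc 0 1) :=
      ContinuousOn.rpow_const (by fun_prop) fun _ _ => Or.inr hp0
    have h2 : ContinuousOn (fun y : ℝ => (1 - y) ^ p) (Set.Icc 0 1) :=
      ContinuousOn.rpow_const (by fun_prop) fun _ _ => Or.inr hp0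
    have h3 : ContinuousOn (fun y : ℝ => (1 + (p - 1) * y ^ 2) ^ (-(p / 2))) (Set.Icc 0 1) :=
      ContinuousOn.rpow_const (by fun_prop) fun y _ => Or.inl (hpos y).ne'
    exact (h1.add h2).mul h3
  have hanti : AntitoneOn f (Set.Icc 0 1) := by
    refine antitoneOn_of_hasDerivWithinAt_nonpos (convex_Icc 0 1) hcont
      (f' := fun y => p * (1 + (p - 1) * y ^ 2) ^ (-(p / 2) - 1) *
        (((1 + y) ^ (p - 1) - (1 - y) ^ (p - 1)) -
          (p - 1) * y * ((1 + y) ^ (p - 1) + (1 - y) ^ (p - 1)))) ?_ ?_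
    · intro y hy
      rw [interior_Icc] at hy
      have hp' : (0 : ℝ) < 1 + y := by linarith [hy.1]
      have hq' : (0 : ℝ) < 1 - y := by linarith [hy.2]
      have d1 : HasDerivAt (fun y : ℝ => (1 + y) ^ p) (1 * p * (1 + y) ^ (p - 1)) y :=
        ((hasDerivAt_id y).const_add 1).rpow_const (Or.inr (by linarith))
      have d2 : HasDerivAt (fun y : ℝ => (1 - y) ^ p) (-1 * p * (1 - y) ^ (p - 1)) y :=
        ((hasDerivAt_id y).const_sub 1).rpow_const (Or.inr (by linarith))
      have d3 : HasDerivAt (fun y : ℝ => (1 + (p - 1) * y ^ 2) ^ (-(p / 2)))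
          ((p - 1) * (2 * y ^ 1 * 1) * (-(p / 2)) * (1 + (p - 1) * y ^ 2) ^ (-(p / 2) - 1)) y := by
        have := (((hasDerivAt_id y).pow 2).const_mul (p - 1)).const_add 1
        exact (this.rpow_const (p := -(p / 2)) (Or.inl (hpos y).ne')).congr_deriv (by simp)
      have e1 : (1 + y) ^ p = (1 + y) * (1 + y) ^ (p - 1) := by
        rw [Real.rpow_sub_one hp'.ne']; field_simp
      have e2 : (1 - y) ^ p = (1 - y) * (1 - y) ^ (p - 1) := by
        rw [Real.rpow_sub_one hq'.ne']; field_simp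
      have e3 : (1 + (p - 1) * y ^ 2) ^ (-(p / 2)) =
          (1 + (p - 1) * y ^ 2) * (1 + (p - 1) * y ^ 2) ^ (-(p / 2) - 1) := by
        rw [Real.rpow_sub_one (hpos y).ne', mul_div_cancel₀ _ (hpos y).ne']
      refine HasDerivAt.hasDerivWithinAt (((d1.add d2).mul d3).congr_deriv ?_)
      simp only [Pi.add_apply]
      rw [e1, e2, e3]
      ring
    · intro y hy
      rw [interior_Icc] at hy
      have := one_add_rpow_sub_one_sub_rpow_le (m := p - 1) (by linarith) hy.1.le hy.2.le
      exact mul_nonpos_of_nonneg_of_nonpos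
        (mul_nonneg hp0 (Real.rpow_nonneg (hpos y).le _)) (by linarith)
  have h0 : f x ≤ f 0 := hanti ⟨le_rfl, zero_le_one⟩ ⟨hx0, hx1⟩ hx0
  have hf0 : f 0 = 2 := by norm_num [f]
  rw [hf0] at h0
  have hx : 0 < (1 + (p - 1) * x ^ 2) ^ (p / 2) := Real.rpow_pos_of_pos (hpos x) _
  simp only [f] at h0
  rw [Real.rpow_neg (hpos x).le, ← div_eq_mul_inv, div_le_iff₀ hx] at h0
  exact h0

/-- The two-point inequality expressing the `2`-uniform smoothness of `L^p` with its optimal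
constant. -/
theorem abs_add_rpow_add_abs_sub_rpow_le {p : ℝ} (hp : 2 ≤ p) (a b : ℝ) :
    |a + b| ^ p + |a - b| ^ p ≤ 2 * (a ^ 2 + (p - 1) * b ^ 2) ^ (p / 2) := by
  have key : ∀ a b : ℝ, 0 ≤ b → b ≤ a →
      |a + b| ^ p + |a - b| ^ p ≤ 2 * (a ^ 2 + (p - 1) * b ^ 2) ^ (p / 2) := by
    intro a b hb hab
    rcases (hb.trans hab).eq_or_lt with h | ha
    · have hb0 : b = 0 := by linarith
      subst hb0; subst h
      have h0 : p ≠ 0 := by linarith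
      simp [Real.zero_rpow h0]
      positivity
    · have hx := one_add_rpow_add_one_sub_rpow_le hp (div_nonneg hb ha.le) ((div_le_one ha).2 hab)
      have e1 : |a + b| ^ p = a ^ p * (1 + b / a) ^ p := by
        rw [← Real.mul_rpow ha.le (by positivity), abs_of_nonneg (by linarith)]
        congr 1; field_simp
      have e2 : |a - b| ^ p = a ^ p * (1 - b / a) ^ p := by
        rw [← Real.mul_rpow ha.le (by linarith [(div_le_one ha).2 hab]),
          abs_of_nonneg (by linarith)]
        congr 1; field_simp
      have e3 : (a ^ 2 + (p - 1) * b ^ 2) ^ (p / 2) =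
          a ^ p * (1 + (p - 1) * (b / a) ^ 2) ^ (p / 2) := by
        have : a ^ p = (a ^ 2) ^ (p / 2) := by
          rw [← Real.rpow_natCast, ← Real.rpow_mul ha.le]; congr 1; push_cast; ring
        rw [this, ← Real.mul_rpow (by positivity)]
        · congr 1; field_simp
        · have : 0 ≤ (p - 1) * (b / a) ^ 2 := mul_nonneg (by linarith) (sq_nonneg _)
          linarith
      rw [e1, e2, e3]
      have := mul_le_mul_of_nonneg_left hx (Real.rpow_nonneg ha.le p)
      linarith
  have key2 : ∀ a b : ℝ, 0 ≤ a → 0 ≤ b →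
      |a + b| ^ p + |a - b| ^ p ≤ 2 * (a ^ 2 + (p - 1) * b ^ 2) ^ (p / 2) := by
    intro a b ha hb
    rcases le_total b a with h | h
    · exact key a b hb h
    -- The left side is symmetric in `a` and `b`; on the right, moving the factor `p - 1 ≥ 1` to the
    -- larger square only increases the sum.
    · have := key b a ha h
      rw [add_comm b a, abs_sub_comm b a] at this
      refine this.trans (mul_le_mul_of_nonneg_left (Real.rpow_le_rpow ?_ ?_ (by linarith)) zero_le_two)
      · have : 0 ≤ (p - 1) * a ^ 2 := mul_nonneg (by linarith) (sq_nonneg _)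
        positivity
      · nlinarith [mul_le_mul h h ha hb]
  have h := key2 |a| |b| (abs_nonneg a) (abs_nonneg b)
  rw [sq_abs, sq_abs] at h
  refine le_trans (le_of_eq ?_) h
  rcases abs_cases a with ⟨h1, _⟩ | ⟨h1, _⟩ <;> rcases abs_cases b with ⟨h2, _⟩ | ⟨h2, _⟩ <;>
    rw [h1, h2]
  · rw [sub_neg_eq_add, ← sub_eq_add_neg, add_comm]
  · rw [← abs_neg (-a + b), ← abs_neg (-a - b), add_comm]
    congr 3 <;> ring
  · rw [← abs_neg (a + b), ← abs_neg (a - b)]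
    congr 3 <;> ring

-- Uniform smoothness of `L^p` and centred increments.

/-- The square of the `L^p` norm, as an extended nonnegative real. -/
noncomputable def lpNormSq {X : Type*} {mX : MeasurableSpace X} (p : ℝ) (μ : Measure X)
    (u : X → ℝ) : ℝ≥0∞ :=
  (∫⁻ x, ‖u x‖ₑ ^ p ∂μ) ^ (2 / p)

theorem lpNormSq_const_mul {X : Type*} {mX : MeasurableSpace X} {p : ℝ} (hp : 0 < p)
    {μ : Measure X} (c : ℝ) (u : X → ℝ) :
    lpNormSq p μ (fun x => c * u x) = ENNReal.ofReal (c ^ 2) * lpNormSq p μ u := by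
  have : ∀ x, ‖c * u x‖ₑ ^ p = ‖c‖ₑ ^ p * ‖u x‖ₑ ^ p := fun x => by
    rw [enorm_mul, ENNReal.mul_rpow_of_nonneg _ _ hp.le]
  simp only [lpNormSq, this]
  rw [lintegral_const_mul' _ _ (ENNReal.rpow_ne_top_of_nonneg hp.le enorm_ne_top),
    ENNReal.mul_rpow_of_nonneg _ _ (by positivity), ← ENNReal.rpow_mul,
    mul_div_cancel₀ _ hp.ne', ENNReal.rpow_two, ← sq_abs, ENNReal.ofReal_pow (abs_nonneg c),
    ← Real.norm_eq_abs, ofReal_norm]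

theorem lpNormSq_map {X Y : Type*} {mX : MeasurableSpace X} {mY : MeasurableSpace Y} {p : ℝ}
    {μ : Measure X} {ν : Measure Y} {φ : X → Y} (hφ : MeasurePreserving φ μ ν) {u : Y → ℝ}
    (hu : Measurable u) : lpNormSq p μ (fun x => u (φ x)) = lpNormSq p ν u := by
  rw [lpNormSq, lpNormSq, ← hφ.lintegral_comp (f := fun y => ‖u y‖ₑ ^ p) (by fun_prop)]

theorem enorm_add_rpow_add_enorm_sub_rpow_le {p : ℝ} (hp : 2 ≤ p) (a b : ℝ) :
    ‖a + b‖ₑ ^ p + ‖a - b‖ₑ ^ p ≤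
      2 * (‖a‖ₑ ^ (2 : ℝ) + ENNReal.ofReal (p - 1) * ‖b‖ₑ ^ (2 : ℝ)) ^ (p / 2) := by
  have hp0 : 0 ≤ p := by linarith
  have e : ∀ (c : ℝ) (q : ℝ), 0 ≤ q → ‖c‖ₑ ^ q = ENNReal.ofReal (|c| ^ q) := fun c q hq => by
    rw [← ofReal_norm, Real.norm_eq_abs, ENNReal.ofReal_rpow_of_nonneg (abs_nonneg c) hq]
  have hb : 0 ≤ (p - 1) * b ^ 2 := mul_nonneg (by linarith) (sq_nonneg b)
  rw [e _ p hp0, e _ p hp0, e _ 2 zero_le_two, e _ 2 zero_le_two,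
    ← ENNReal.ofReal_mul (by linarith), Real.rpow_two, Real.rpow_two, sq_abs, sq_abs,
    ← ENNReal.ofReal_add (by positivity) (by positivity),
    ← ENNReal.ofReal_add (by positivity) hb,
    ENNReal.ofReal_rpow_of_nonneg (by positivity) (by positivity),
    ← ENNReal.ofReal_ofNat, ← ENNReal.ofReal_mul (by norm_num)]
  exact ENNReal.ofReal_le_ofReal (abs_add_rpow_add_abs_sub_rpow_le hp a b)

/-- `2`-uniform smoothness of `L^p`, `p ≥ 2`, with its optimal constant. -/
theorem lpNormSq_add_add_lpNormSq_sub_le {X : Type*} {mX : MeasurableSpace X} {p : ℝ} (hp : 2 ≤ p)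
    (μ : Measure X) {u v : X → ℝ} (hu : Measurable u) (hv : Measurable v) :
    lpNormSq p μ (u + v) + lpNormSq p μ (u - v) ≤
      2 * lpNormSq p μ u + 2 * (ENNReal.ofReal (p - 1) * lpNormSq p μ v) := by
  have hp0 : 0 < p := by linarith
  have hq : 1 ≤ p / 2 := by linarith
  have hq0 : 0 < p / 2 := by linarith
  set c := ENNReal.ofReal (p - 1)
  set W : ℝ≥0∞ := ∫⁻ x, (‖u x‖ₑ ^ (2 : ℝ) + c * ‖v x‖ₑ ^ (2 : ℝ)) ^ (p / 2) ∂μ with hW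
  set U : ℝ≥0∞ := ∫⁻ x, ‖(u + v) x‖ₑ ^ p ∂μ with hU
  set V : ℝ≥0∞ := ∫⁻ x, ‖(u - v) x‖ₑ ^ p ∂μ with hV
  have hUV : U + V ≤ 2 * W := by
    rw [hU, hV, hW, ← lintegral_add_left (by fun_prop), ← lintegral_const_mul _ (by fun_prop)]
    exact lintegral_mono fun x => enorm_add_rpow_add_enorm_sub_rpow_le hp (u x) (v x)
  -- Minkowski in `L^(p / 2)` for the functions `u²` and `(p - 1) v²`.
  have hmink : W ^ (2 / p) ≤ lpNormSq p μ u + c * lpNormSq p μ v := by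
    have h := ENNReal.lintegral_Lp_add_le (μ := μ) (f := fun x => ‖u x‖ₑ ^ (2 : ℝ))
      (g := fun x => c * ‖v x‖ₑ ^ (2 : ℝ)) (by fun_prop) (by fun_prop) hq
    have e1 : ∀ x, (‖u x‖ₑ ^ (2 : ℝ)) ^ (p / 2) = ‖u x‖ₑ ^ p := fun x => by
      rw [← ENNReal.rpow_mul]; congr 1; ring
    have e2 : ∀ x, (c * ‖v x‖ₑ ^ (2 : ℝ)) ^ (p / 2) = c ^ (p / 2) * ‖v x‖ₑ ^ p := fun x => by
      rw [ENNReal.mul_rpow_of_nonneg _ _ hq0.le, ← ENNReal.rpow_mul]; congr 2; ring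
    have e3 : 1 / (p / 2) = 2 / p := by field_simp
    simp only [e1, e2, e3, Pi.add_apply] at h
    rw [lintegral_const_mul _ (by fun_prop), ENNReal.mul_rpow_of_nonneg _ _ (by positivity),
      ← ENNReal.rpow_mul, show p / 2 * (2 / p) = 1 by field_simp, ENNReal.rpow_one] at h
    exact h
  -- Power mean inequality: its factor `2 ^ (p / 2 - 1)` and the `2` of `hUV` combine to `2 ^ (p /
  -- 2)`, so no constant is lost.
  have hpow : (U ^ (2 / p) + V ^ (2 / p)) ^ (p / 2) ≤ (2 * W ^ (2 / p)) ^ (p / 2) := by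
    refine (ENNReal.rpow_add_le_mul_rpow_add_rpow _ _ hq).trans ?_
    rw [← ENNReal.rpow_mul, ← ENNReal.rpow_mul, ENNReal.mul_rpow_of_nonneg _ _ hq0.le,
      ← ENNReal.rpow_mul, show 2 / p * (p / 2) = 1 by field_simp, ENNReal.rpow_one,
      ENNReal.rpow_one, ENNReal.rpow_one]
    refine (mul_le_mul_right hUV _).trans (le_of_eq ?_)
    rw [← mul_assoc]
    congr 1
    nth_rewrite 2 [← ENNReal.rpow_one 2]
    rw [← ENNReal.rpow_add _ _ (by norm_num) (by norm_num)]
    congr 1; ring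
  have h2 : U ^ (2 / p) + V ^ (2 / p) ≤ 2 * W ^ (2 / p) := (ENNReal.rpow_le_rpow_iff hq0).1 hpow
  calc lpNormSq p μ (u + v) + lpNormSq p μ (u - v) ≤ 2 * W ^ (2 / p) := h2
    _ ≤ 2 * (lpNormSq p μ u + c * lpNormSq p μ v) := mul_le_mul_right hmink _
    _ = _ := by rw [mul_add]

/-- One step of length `1` from the minimum would only give `φ 0 + 2 K`. With steps of length `s`,
the `k`-th increment is at most `2 K s² k`, so `N + 1` steps of length `1 / (N + 1)` cost `K (1 + 1
/ (N + 1))`; let `N → ∞`. This is what keeps the constant `p - 1` below. -/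
theorem le_add_of_second_difference_le {φ : ℝ → ℝ} {K : ℝ}
    (h2 : ∀ t s, φ (t + s) + φ (t - s) ≤ 2 * φ t + 2 * (K * s ^ 2)) (h0 : ∀ t, φ 0 ≤ φ t) :
    φ 1 ≤ φ 0 + K := by
  have key : ∀ (s : ℝ) (k : ℕ), φ ((k + 1) * s) - φ (k * s) ≤ 2 * K * s ^ 2 * (k + 1) ∧
      φ (k * s) ≤ φ 0 + K * s ^ 2 * (k * (k + 1)) := by
    intro s k
    induction k with
    | zero =>
      have h := h2 0 s
      have h' := h0 (0 - s)
      norm_num at h h' ⊢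
      linarith
    | succ k ih =>
      have h := h2 ((k + 1) * s) s
      rw [show ((k : ℝ) + 1) * s + s = (k + 1 + 1) * s by ring,
        show ((k : ℝ) + 1) * s - s = k * s by ring] at h
      push_cast
      constructor <;> nlinarith [ih.1, ih.2]
  have hN : ∀ N : ℕ, φ 1 ≤ φ 0 + K + K * (1 / ((N : ℝ) + 1)) := by
    intro N
    have hpos : (0 : ℝ) < N + 1 := by positivity
    have h := (key (1 / ((N : ℝ) + 1)) (N + 1)).2
    push_cast at h
    rw [mul_one_div_cancel hpos.ne'] at h
    refine h.trans (le_of_eq ?_)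
    field_simp
    ring
  have hlim : Filter.Tendsto (fun N : ℕ => φ 0 + K + K * (1 / ((N : ℝ) + 1))) Filter.atTop
      (nhds (φ 0 + K + K * 0)) :=
    (tendsto_one_div_add_atTop_nhds_zero_nat.const_mul K).const_add _
  have := ge_of_tendsto' hlim hN
  linarith

/-- Smoothness bounds the second differences of `t ↦ ‖f + t g‖²`, and the hypothesis says that this
function is minimal at `0`. Infinite norms are split off so that the argument runs over the reals.
-/
theorem lpNormSq_add_le_of_forall_le {X : Type*} {mX : MeasurableSpace X} {p : ℝ} (hp : 2 ≤ p)
    (μ : Measure X) {f g : X → ℝ} (hf : Measurable f) (hg : Measurable g)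
    (h : ∀ t : ℝ, lpNormSq p μ f ≤ lpNormSq p μ (fun x => f x + t * g x)) :
    lpNormSq p μ (fun x => f x + g x) ≤
      lpNormSq p μ f + ENNReal.ofReal (p - 1) * lpNormSq p μ g := by
  have hp0 : 0 < p := by linarith
  by_cases hF : lpNormSq p μ f = ⊤
  · simp [hF]
  by_cases hG : lpNormSq p μ g = ⊤
  · rw [hG, ENNReal.mul_top (by simp; linarith)]; simp
  have hsmooth : ∀ t s : ℝ, lpNormSq p μ (fun x => f x + (t + s) * g x) +
      lpNormSq p μ (fun x => f x + (t - s) * g x) ≤ 2 * lpNormSq p μ (fun x => f x + t * g x) +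
        2 * (ENNReal.ofReal (p - 1) * (ENNReal.ofReal (s ^ 2) * lpNormSq p μ g)) := by
    intro t s
    have := lpNormSq_add_add_lpNormSq_sub_le hp μ (u := fun x => f x + t * g x)
      (v := fun x => s * g x) (by fun_prop) (by fun_prop)
    rw [lpNormSq_const_mul hp0] at this
    convert this using 3 <;> ext x <;> simp only [Pi.add_apply, Pi.sub_apply] <;> ring
  have hfin : ∀ t : ℝ, lpNormSq p μ (fun x => f x + t * g x) ≠ ⊤ := by
    intro t
    have := hsmooth 0 t
    simp only [zero_mul, add_zero, zero_add] at this
    refine ne_top_of_le_ne_top ?_ (le_self_add.trans this)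
    finiteness
  have := le_add_of_second_difference_le
    (φ := fun t => (lpNormSq p μ (fun x => f x + t * g x)).toReal)
    (K := (p - 1) * (lpNormSq p μ g).toReal) ?_ ?_
  · simp only [one_mul, zero_mul, add_zero] at this
    rw [← ENNReal.toReal_ofReal (show 0 ≤ p - 1 by linarith), ← ENNReal.toReal_mul,
      ← ENNReal.toReal_add hF (by finiteness)] at this
    have h1 := hfin 1
    simp only [one_mul] at h1
    exact (ENNReal.toReal_le_toReal h1 (by finiteness)).1 this
  · intro t s
    have h1 := hsmooth t s
    have h3 := hfin t
    rw [← ENNReal.toReal_le_toReal (ENNReal.add_ne_top.2 ⟨hfin _, hfin _⟩) (by finiteness),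
      ENNReal.toReal_add (hfin _) (hfin _), ENNReal.toReal_add (by finiteness) (by finiteness)] at h1
    simp only [ENNReal.toReal_mul, ENNReal.toReal_ofNat,
      ENNReal.toReal_ofReal (show 0 ≤ p - 1 by linarith), ENNReal.toReal_ofReal (sq_nonneg s)] at h1
    refine h1.trans (le_of_eq ?_)
    ring
  · intro t
    have h1 := h t
    simp only [zero_mul, add_zero]
    exact ENNReal.toReal_mono (hfin t) h1

theorem enorm_integral_rpow_le {X : Type*} {mX : MeasurableSpace X} {p : ℝ} (hp : 1 ≤ p)
    (μ : Measure X) [IsProbabilityMeasure μ] {h : X → ℝ} (hh : AEMeasurable h μ) :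
    ‖∫ x, h x ∂μ‖ₑ ^ p ≤ ∫⁻ x, ‖h x‖ₑ ^ p ∂μ := by
  have hp0 : 0 < p := by linarith
  have h1 := eLpNorm'_le_eLpNorm'_of_exponent_le zero_lt_one hp μ hh.aestronglyMeasurable
  simp only [eLpNorm', ENNReal.rpow_one, div_one] at h1
  calc ‖∫ x, h x ∂μ‖ₑ ^ p ≤ ((∫⁻ x, ‖h x‖ₑ ^ p ∂μ) ^ (1 / p)) ^ p :=
        ENNReal.rpow_le_rpow ((enorm_integral_le_lintegral_enorm _).trans h1) hp0.le
    _ = _ := by rw [← ENNReal.rpow_mul, one_div_mul_cancel hp0.ne', ENNReal.rpow_one]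

/-- For fixed `y` the mean of `f y + t g (x, y)` in `x` is `f y`, so by Jensen `f` has the smallest
norm on the line `f + t g`. This is the martingale-difference step of the Efron–Stein induction. -/
theorem lpNormSq_comp_snd_add_le {X Y : Type*} {mX : MeasurableSpace X} {mY : MeasurableSpace Y}
    {p : ℝ} (hp : 2 ≤ p) (μ : Measure X) [IsProbabilityMeasure μ] (ν : Measure Y) [SFinite ν]
    {f : Y → ℝ} {g : X × Y → ℝ} (hf : Measurable f) (hg : Measurable g)
    (hgi : ∀ᵐ y ∂ν, Integrable (fun x => g (x, y)) μ)
    (hg0 : ∀ᵐ y ∂ν, ∫ x, g (x, y) ∂μ = 0) :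
    lpNormSq p (μ.prod ν) (fun z => f z.2 + g z) ≤
      lpNormSq p ν f + ENNReal.ofReal (p - 1) * lpNormSq p (μ.prod ν) g := by
  have hsnd : lpNormSq p (μ.prod ν) (fun z => f z.2) = lpNormSq p ν f :=
    lpNormSq_map measurePreserving_snd hf
  rw [← hsnd]
  refine lpNormSq_add_le_of_forall_le hp _ (by fun_prop) hg fun t => ?_
  rw [hsnd]
  refine ENNReal.rpow_le_rpow ?_ (by positivity)
  rw [lintegral_prod_symm' _ (by fun_prop)]
  refine lintegral_mono_ae ?_
  filter_upwards [hgi, hg0] with y hy hy0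
  have h := enorm_integral_rpow_le (p := p) (by linarith) μ (h := fun x => f y + t * g (x, y))
    (by fun_prop)
  rwa [integral_add (integrable_const _) (hy.const_mul t), integral_const_mul, hy0,
    integral_const, probReal_univ, one_smul, mul_zero, add_zero] at h

-- Resampling under product measures and the Efron–Stein inequality.

theorem measurePreserving_update {ι E : Type*} [Fintype ι] [DecidableEq ι] [MeasurableSpace E]
    (μ : ι → Measure E) [∀ i, IsProbabilityMeasure (μ i)] (i : ι) :
    MeasurePreserving (fun z : (ι → E) × E => Function.update z.1 i z.2)
      ((Measure.pi μ).prod (μ i)) (Measure.pi μ) := by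
  have hm : Measurable fun z : (ι → E) × E => Function.update z.1 i z.2 := by
    refine measurable_pi_lambda _ fun j => ?_
    by_cases h : j = i
    · subst h; simpa using measurable_snd
    · simp only [Function.update_of_ne h]; fun_prop
  refine ⟨hm, (Measure.pi_eq fun s hs => ?_).symm⟩
  rw [Measure.map_apply hm (MeasurableSet.univ_pi hs)]
  have : (fun z : (ι → E) × E => Function.update z.1 i z.2) ⁻¹' Set.univ.pi s =
      (Set.univ.pi (Function.update s i Set.univ)) ×ˢ s i := by
    ext z
    simp only [Set.mem_preimage, Set.mem_pi, Set.mem_univ, true_implies, Set.mem_prod]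
    constructor
    · refine fun h => ⟨fun j => ?_, by simpa using h i⟩
      by_cases hj : j = i
      · subst hj; simp
      · simpa [Function.update_of_ne hj] using h j
    · rintro ⟨h1, h2⟩ j
      by_cases hj : j = i
      · subst hj; simpa using h2
      · simpa [Function.update_of_ne hj] using h1 j
  rw [this, Measure.prod_prod, Measure.pi_pi, ← Finset.prod_erase_mul _ _ (Finset.mem_univ i),
    ← Finset.prod_erase_mul (f := fun j => μ j (s j)) _ (Finset.mem_univ i)]
  simp only [Function.update_self, measure_univ, mul_one]
  congr 1
  refine Finset.prod_congr rfl fun j hj => ?_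
  rw [Function.update_of_ne (Finset.ne_of_mem_erase hj)]

theorem measurePreserving_finCons {E : Type*} [MeasurableSpace E] {n : ℕ}
    (μ : Fin (n + 1) → Measure E) [∀ i, IsProbabilityMeasure (μ i)] :
    MeasurePreserving (fun z : E × (Fin n → E) => (Fin.cons z.1 z.2 : Fin (n + 1) → E))
      ((μ 0).prod (Measure.pi fun i : Fin n => μ i.succ)) (Measure.pi μ) := by
  have hm : Measurable fun z : E × (Fin n → E) => (Fin.cons z.1 z.2 : Fin (n + 1) → E) := by
    refine measurable_pi_lambda _ fun j => ?_
    refine Fin.cases ?_ (fun j => ?_) j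
    · simpa using measurable_fst
    · simp only [Fin.cons_succ]; fun_prop
  refine ⟨hm, (Measure.pi_eq fun s hs => ?_).symm⟩
  rw [Measure.map_apply hm (MeasurableSet.univ_pi hs)]
  have : (fun z : E × (Fin n → E) => (Fin.cons z.1 z.2 : Fin (n + 1) → E)) ⁻¹' Set.univ.pi s =
      s 0 ×ˢ (Set.univ.pi fun i : Fin n => s i.succ) := by
    ext z
    simp [Set.mem_pi, Fin.forall_fin_succ]
  rw [this, Measure.prod_prod, Measure.pi_pi, Fin.prod_univ_succ]

/-- The squared `L^p` size of the effect of resampling the coordinate `i`. -/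
noncomputable def resampleSq {E ι : Type*} [MeasurableSpace E] [Fintype ι] [DecidableEq ι] (p : ℝ)
    (μ : ι → Measure E) (G : (ι → E) → ℝ) (i : ι) : ℝ≥0∞ :=
  lpNormSq p ((Measure.pi μ).prod (μ i)) fun z => G z.1 - G (Function.update z.1 i z.2)

/-- Averaging out the first coordinate does not increase the effect of resampling another one. -/
theorem resampleSq_integral_finCons_le {E : Type*} [MeasurableSpace E] {p : ℝ} (hp : 1 ≤ p) {n : ℕ}
    (μ : Fin (n + 1) → Measure E) [∀ i, IsProbabilityMeasure (μ i)]
    {G : (Fin (n + 1) → E) → ℝ} (hG : Measurable G) (hGi : Integrable G (Measure.pi μ))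
    (i : Fin n) :
    resampleSq p (fun i : Fin n => μ i.succ)
      (fun y => ∫ x, G (Fin.cons x y : Fin (n + 1) → E) ∂(μ 0)) i ≤ resampleSq p μ G i.succ := by
  have hcons := measurePreserving_finCons μ
  set π := Measure.pi fun i : Fin n => μ i.succ
  have hupd : MeasurePreserving (fun z : (Fin n → E) × E => Function.update z.1 i z.2)
    (π.prod (μ i.succ)) π := measurePreserving_update (fun i : Fin n => μ i.succ) i
  have hGc : Measurable fun z : E × (Fin n → E) => G (Fin.cons z.1 z.2 : Fin (n + 1) → E) :=
    hG.comp hcons.measurable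
  have hsl : ∀ᵐ y ∂π, Integrable (fun x => G (Fin.cons x y : Fin (n + 1) → E)) (μ 0) :=
    (hcons.integrable_comp_of_integrable hGi).prod_left_ae
  have hsl1 : ∀ᵐ z ∂(π.prod (μ i.succ)),
      Integrable (fun x => G (Fin.cons x z.1 : Fin (n + 1) → E)) (μ 0) :=
    measurePreserving_fst.quasiMeasurePreserving.ae hsl
  have hsl2 : ∀ᵐ z ∂(π.prod (μ i.succ)), Integrable
      (fun x => G (Fin.cons x (Function.update z.1 i z.2) : Fin (n + 1) → E)) (μ 0) :=
    hupd.quasiMeasurePreserving.ae hsl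
  have hψ : MeasurePreserving
      (fun w : E × ((Fin n → E) × E) => ((Fin.cons w.1 w.2.1 : Fin (n + 1) → E), w.2.2))
      ((μ 0).prod (π.prod (μ i.succ))) ((Measure.pi μ).prod (μ i.succ)) :=
    (hcons.prod (MeasurePreserving.id (μ i.succ))).comp
      (measurePreserving_prodAssoc (μ 0) π (μ i.succ)).symm
  have hsucc := (measurePreserving_update μ i.succ).measurable
  have hD : Measurable fun z : (Fin (n + 1) → E) × E =>
      G z.1 - G (Function.update z.1 i.succ z.2) :=
    (hG.comp measurable_fst).sub (hG.comp hsucc)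
  rw [resampleSq, resampleSq, ← lpNormSq_map hψ hD]
  refine ENNReal.rpow_le_rpow ?_ (by positivity)
  have hD' := hD.comp hψ.measurable
  refine le_of_le_of_eq ?_ (lintegral_prod_symm' _ (hD'.enorm.pow_const p)).symm
  refine lintegral_mono_ae ?_
  filter_upwards [hsl1, hsl2] with z h1 h2
  have hmz : Measurable fun x : E => G (Fin.cons x z.1 : Fin (n + 1) → E) -
      G (Fin.cons x (Function.update z.1 i z.2) : Fin (n + 1) → E) :=
    (hGc.comp measurable_prodMk_right).sub (hGc.comp measurable_prodMk_right)
  rw [← integral_sub h1 h2]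
  -- Jensen in the averaged coordinate; updating coordinate `i.succ` commutes with prepending it.
  refine (enorm_integral_rpow_le hp (μ 0) hmz.aemeasurable).trans (le_of_eq ?_)
  simp only [Fin.cons_update, Function.comp_apply]

/-- Averaging out the first coordinate costs at most the effect of resampling it. -/
theorem lpNormSq_sub_integral_finCons_le {E : Type*} [MeasurableSpace E] {p : ℝ} (hp : 1 ≤ p)
    {n : ℕ} (μ : Fin (n + 1) → Measure E) [∀ i, IsProbabilityMeasure (μ i)]
    {G : (Fin (n + 1) → E) → ℝ} (hG : Measurable G) (hGi : Integrable G (Measure.pi μ)) :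
    lpNormSq p ((μ 0).prod (Measure.pi fun i : Fin n => μ i.succ))
      (fun z => G (Fin.cons z.1 z.2 : Fin (n + 1) → E) -
        ∫ x, G (Fin.cons x z.2 : Fin (n + 1) → E) ∂(μ 0)) ≤ resampleSq p μ G 0 := by
  have hcons := measurePreserving_finCons μ
  set π := Measure.pi fun i : Fin n => μ i.succ
  have hGc : Measurable fun z : E × (Fin n → E) => G (Fin.cons z.1 z.2 : Fin (n + 1) → E) :=
    hG.comp hcons.measurable
  have hsl : ∀ᵐ z ∂((μ 0).prod π),
      Integrable (fun x => G (Fin.cons x z.2 : Fin (n + 1) → E)) (μ 0) :=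
    measurePreserving_snd.quasiMeasurePreserving.ae
      (hcons.integrable_comp_of_integrable hGi).prod_left_ae
  have hψ : MeasurePreserving
      (fun w : (E × (Fin n → E)) × E => ((Fin.cons w.1.1 w.1.2 : Fin (n + 1) → E), w.2))
      (((μ 0).prod π).prod (μ 0)) ((Measure.pi μ).prod (μ 0)) :=
    hcons.prod (MeasurePreserving.id (μ 0))
  have hD : Measurable fun z : (Fin (n + 1) → E) × E => G z.1 - G (Function.update z.1 0 z.2) :=
    (hG.comp measurable_fst).sub (hG.comp (measurePreserving_update μ 0).measurable)
  rw [resampleSq, ← lpNormSq_map hψ hD]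
  refine ENNReal.rpow_le_rpow ?_ (by positivity)
  have hD' := hD.comp hψ.measurable
  refine le_of_le_of_eq ?_ (lintegral_prod _ (hD'.enorm.pow_const p).aemeasurable).symm
  refine lintegral_mono_ae ?_
  filter_upwards [hsl] with z h1
  have hmz : Measurable fun y : E => G (Fin.cons z.1 z.2 : Fin (n + 1) → E) -
      G (Fin.cons y z.2 : Fin (n + 1) → E) :=
    measurable_const.sub (hGc.comp measurable_prodMk_right)
  -- The variable averaged over acts as the independent copy: `G` minus its average is the mean of
  -- the resampling difference, to which Jensen applies.
  have e := integral_sub (integrable_const (G (Fin.cons z.1 z.2 : Fin (n + 1) → E))) h1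
  rw [integral_const, probReal_univ, one_smul] at e
  rw [← e]
  refine (enorm_integral_rpow_le hp (μ 0) hmz.aemeasurable).trans (le_of_eq ?_)
  simp only [Function.comp_apply, Fin.update_cons_zero]

/-- The Efron–Stein inequality in `L^p`, `p ≥ 2`, with constant `p - 1`. -/
theorem lpNormSq_sub_integral_le_sum_resampleSq {E : Type*} [MeasurableSpace E] {p : ℝ}
    (hp : 2 ≤ p) : ∀ {n : ℕ} (μ : Fin n → Measure E) [∀ i, IsProbabilityMeasure (μ i)]
    {G : (Fin n → E) → ℝ}, Measurable G → Integrable G (Measure.pi μ) →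
    lpNormSq p (Measure.pi μ) (fun x => G x - ∫ y, G y ∂(Measure.pi μ)) ≤
      ENNReal.ofReal (p - 1) * ∑ i, resampleSq p μ G i := by
  intro n
  induction n with
  | zero =>
    intro μ _ G hG hGi
    have : ∀ x, G x - ∫ y, G y ∂(Measure.pi μ) = 0 := fun x => by
      rw [integral_congr_ae (g := fun _ => G x)
        (Filter.Eventually.of_forall fun y => congrArg G (Subsingleton.elim y x)),
        integral_const, probReal_univ, one_smul, sub_self]
    have hp0 : 0 < p := by linarith
    simp [this, lpNormSq, hp0]
  | succ n ih =>
    intro μ _ G hG hGi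
    have hcons := measurePreserving_finCons μ
    have hres0 := lpNormSq_sub_integral_finCons_le (p := p) (by linarith) μ hG hGi
    have hres := resampleSq_integral_finCons_le (p := p) (by linarith) μ hG hGi
    set π := Measure.pi fun i : Fin n => μ i.succ with hπ
    have hGc : Measurable fun z : E × (Fin n → E) => G (Fin.cons z.1 z.2 : Fin (n + 1) → E) :=
      hG.comp hcons.measurable
    have hGci := hcons.integrable_comp_of_integrable hGi
    set H : (Fin n → E) → ℝ := fun y => ∫ x, G (Fin.cons x y : Fin (n + 1) → E) ∂(μ 0) with hH
    have hHm : Measurable H := hGc.stronglyMeasurable.integral_prod_left'.measurable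
    have hHi : Integrable H π := hGci.integral_prod_right
    have hc : ∫ y, G y ∂(Measure.pi μ) = ∫ y, H y ∂π := by
      rw [← hcons.map_eq, integral_map hcons.measurable.aemeasurable
        hG.aestronglyMeasurable]
      exact integral_prod_symm _ hGci
    have hGm : Measurable fun x => G x - ∫ y, H y ∂π := hG.sub_const _
    rw [hc, ← lpNormSq_map hcons hGm]
    -- `G - E G = (H - E H) + (G - H)`: the first summand does not involve coordinate `0` and goes
    -- to the induction hypothesis, the second has zero mean in coordinate `0`.
    have hstep := lpNormSq_comp_snd_add_le hp (μ 0) π (f := fun y => H y - ∫ y, H y ∂π)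
      (g := fun z => G (Fin.cons z.1 z.2 : Fin (n + 1) → E) - H z.2) (hHm.sub_const _)
      (hGc.sub (hHm.comp measurable_snd))
      (by filter_upwards [hGci.prod_left_ae] with y hy using hy.sub (integrable_const _))
      (by
        filter_upwards [hGci.prod_left_ae] with y hy
        have e := integral_sub hy (integrable_const (H y))
        rw [integral_const, probReal_univ, one_smul] at e
        exact e.trans (sub_self _))
    have hcongr : (fun z : E × (Fin n → E) => G (Fin.cons z.1 z.2 : Fin (n + 1) → E) -
        ∫ y, H y ∂π) = fun z => (H z.2 - ∫ y, H y ∂π) +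
          (G (Fin.cons z.1 z.2 : Fin (n + 1) → E) - H z.2) := by
      ext z; ring
    rw [hcongr]
    refine hstep.trans ?_
    rw [Fin.sum_univ_succ, mul_add, add_comm]
    refine add_le_add (mul_le_mul_right hres0 _) ?_
    refine (ih (fun i : Fin n => μ i.succ) hHm hHi).trans ?_
    exact mul_le_mul_right (Finset.sum_le_sum fun i _ => hres i) _

-- Conditional laws as product kernels.

theorem measurePreserving_optionElim {ι E : Type*} [Fintype ι] [MeasurableSpace E]
    (μ : Option ι → Measure E) [∀ i, IsProbabilityMeasure (μ i)] :
    MeasurePreserving (fun (z : (ι → E) × E) (o : Option ι) => o.elim z.2 z.1)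
      ((Measure.pi fun i => μ (some i)).prod (μ none)) (Measure.pi μ) := by
  have hm : Measurable fun (z : (ι → E) × E) (o : Option ι) => o.elim z.2 z.1 := by
    refine measurable_pi_lambda _ fun o => ?_
    cases o with
    | none => exact measurable_snd
    | some i => exact (measurable_pi_apply i).comp measurable_fst
  refine ⟨hm, (Measure.pi_eq fun s hs => ?_).symm⟩
  rw [Measure.map_apply hm (MeasurableSet.univ_pi hs)]
  have : (fun (z : (ι → E) × E) (o : Option ι) => o.elim z.2 z.1) ⁻¹' Set.univ.pi s =
      (Set.univ.pi fun i => s (some i)) ×ˢ s none := by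
    ext z
    simp [Set.mem_pi, Option.forall, and_comm]
  rw [this, Measure.prod_prod, Measure.pi_pi, Fintype.prod_option, mul_comm]

/-- The kernel of product measures of a finite family of Markov kernels. -/
noncomputable def piKernel {α ι E : Type*} {mα : MeasurableSpace α} [MeasurableSpace E] [Fintype ι]
    (κ : ι → Kernel α E) [∀ i, IsMarkovKernel (κ i)] : Kernel α (ι → E) where
  toFun a := Measure.pi fun i => κ i a
  measurable' := by
    refine Measurable.measure_of_isPiSystem_of_isProbabilityMeasure generateFrom_pi.symm
      isPiSystem_pi ?_
    rintro _ ⟨B, hB, rfl⟩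
    simp only [Measure.pi_pi]
    exact Finset.measurable_prod _ fun i _ =>
      (κ i).measurable_coe (hB i (Set.mem_univ i))

theorem piKernel_apply {α ι E : Type*} {mα : MeasurableSpace α} [MeasurableSpace E] [Fintype ι]
    (κ : ι → Kernel α E) [∀ i, IsMarkovKernel (κ i)] (a : α) :
    piKernel κ a = Measure.pi fun i => κ i a := rfl

instance isMarkovKernel_piKernel {α ι E : Type*} {mα : MeasurableSpace α} [MeasurableSpace E]
    [Fintype ι] (κ : ι → Kernel α E) [∀ i, IsMarkovKernel (κ i)] :
    IsMarkovKernel (piKernel κ) :=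
  ⟨fun a => by rw [piKernel_apply]; infer_instance⟩

section
variable {Ω β : Type*} {mΩ : MeasurableSpace Ω} {mβ : MeasurableSpace β} {μ : Measure Ω}
  [IsProbabilityMeasure μ] {X : Ω → β}

/-- The defining identity of conditional probability given `X`, moved to the space where `X` takes
its values, where it can be compared with kernels. -/
theorem setLIntegral_map_eq_measure_inter (hX : Measurable X) {A : Set Ω} (hA : MeasurableSet A)
    {g : β → ℝ≥0∞} (hg : Measurable g) (hg1 : ∀ b, g b ≠ ⊤)
    (h : μ⟦A | mβ.comap X⟧ =ᵐ[μ] fun ω => (g (X ω)).toReal) {t : Set β} (ht : MeasurableSet t) :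
    ∫⁻ b in t, g b ∂(μ.map X) = μ (X ⁻¹' t ∩ A) := by
  have hA1 : Integrable (A.indicator fun _ => (1 : ℝ)) μ := (integrable_const 1).indicator hA
  have h1 := setIntegral_condExp (μ := μ) hX.comap_le hA1 (s := X ⁻¹' t) ⟨t, ht, rfl⟩
  have h2 : ∫ ω in X ⁻¹' t, (g (X ω)).toReal ∂μ = μ.real (X ⁻¹' t ∩ A) := by
    rw [← setIntegral_congr_ae (g := fun ω => (g (X ω)).toReal) (hX ht)
      (by filter_upwards [h] with ω hω _ using hω), h1, setIntegral_indicator hA]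
    simp
  have hint : Integrable (fun ω => (g (X ω)).toReal) μ := integrable_condExp.congr h
  rw [setLIntegral_map ht hg hX]
  have h3 : ∫⁻ ω in X ⁻¹' t, g (X ω) ∂μ =
      ENNReal.ofReal (∫ ω in X ⁻¹' t, (g (X ω)).toReal ∂μ) := by
    rw [ofReal_integral_eq_lintegral_ofReal hint.integrableOn
      (Filter.Eventually.of_forall fun _ => ENNReal.toReal_nonneg)]
    simp only [ENNReal.ofReal_toReal (hg1 _)]
  rw [h3, h2, ofReal_measureReal]

/-- The joint conditional law of a conditionally independent family is the product of the
conditional laws of its members. -/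
theorem map_prodMk_eq_compProd_piKernel {ι E : Type*} [Fintype ι] [MeasurableSpace E]
    (hX : Measurable X) {f : ι → Ω → E} (hf : ∀ i, Measurable (f i))
    (hind : CondIndepFamily (mβ.comap X) μ f) (κ : ι → Kernel β E) [∀ i, IsMarkovKernel (κ i)]
    (hκ : ∀ i B, MeasurableSet B →
      μ⟦f i ⁻¹' B | mβ.comap X⟧ =ᵐ[μ] fun ω => (κ i (X ω) B).toReal) :
    μ.map (fun ω => (X ω, fun i => f i ω)) = μ.map X ⊗ₘ piKernel κ := by
  have hfm : Measurable fun ω => fun i => f i ω := measurable_pi_lambda _ hf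
  have : IsProbabilityMeasure (μ.map X) := Measure.isProbabilityMeasure_map hX.aemeasurable
  refine Measure.ext_prod fun {t s} ht hs => ?_
  rw [Measure.compProd_apply_prod ht hs, Measure.map_apply (hX.prodMk hfm) (ht.prod hs),
    Set.mk_preimage_prod]
  -- With `t` fixed, both sides are finite measures in the second coordinate, so it suffices to
  -- compare them on boxes, where conditional independence factorizes the probability.
  have hbox : ∀ B : ι → Set E, (∀ i, MeasurableSet (B i)) →
      ((μ.restrict (X ⁻¹' t)).map fun ω i => f i ω) (Set.univ.pi B) =
        (((μ.map X).restrict t).bind (piKernel κ)) (Set.univ.pi B) := by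
    intro B hB
    have hBm := MeasurableSet.univ_pi hB
    rw [Measure.map_apply hfm hBm, Measure.restrict_apply (hfm hBm),
      Measure.bind_apply hBm (piKernel κ).aemeasurable, Set.inter_comm]
    refine (setLIntegral_map_eq_measure_inter hX (hfm hBm) ((piKernel κ).measurable_coe hBm)
      (fun b => measure_ne_top _ _) ?_ ht).symm
    have hpre : (fun ω i => f i ω) ⁻¹' Set.univ.pi B = ⋂ i ∈ Finset.univ, f i ⁻¹' B i := by
      ext ω; simp [Set.mem_pi]
    rw [hpre]
    refine (hind Finset.univ B fun i _ => hB i).trans ?_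
    have hall : ∀ᵐ ω ∂μ, ∀ i, (μ⟦f i ⁻¹' B i | mβ.comap X⟧) ω = (κ i (X ω) (B i)).toReal :=
      ae_all_iff.2 fun i => hκ i (B i) (hB i)
    filter_upwards [hall] with ω hω
    rw [Finset.prod_apply, piKernel_apply, Measure.pi_pi, ENNReal.toReal_prod]
    exact Finset.prod_congr rfl fun i _ => hω i
  have heq : (μ.restrict (X ⁻¹' t)).map (fun ω i => f i ω) =
      ((μ.map X).restrict t).bind (piKernel κ) := by
    refine ext_of_generate_finite _ generateFrom_pi.symm isPiSystem_pi ?_ ?_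
    · rintro _ ⟨B, hB, rfl⟩
      exact hbox B fun i => hB i (Set.mem_univ i)
    · have := hbox (fun _ => Set.univ) fun _ => MeasurableSet.univ
      rwa [Set.pi_univ] at this
  have := congrArg (fun ρ => ρ s) heq
  simp only [Measure.bind_apply hs (piKernel κ).aemeasurable] at this
  rw [← this, Measure.map_apply hfm hs, Measure.restrict_apply (hfm hs), Set.inter_comm]

theorem condLExp_ae_eq_lintegral {E : Type*} [MeasurableSpace E] (hX : Measurable X) {Y : Ω → E}
    (hY : Measurable Y) {κ : Kernel β E} [IsMarkovKernel κ]
    (h : μ.map (fun ω => (X ω, Y ω)) = μ.map X ⊗ₘ κ) {f : E → ℝ≥0∞} (hf : Measurable f) :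
    μ⁻[fun ω => f (Y ω) | mβ.comap X] =ᵐ[μ] fun ω => ∫⁻ y, f y ∂(κ (X ω)) := by
  have : IsProbabilityMeasure (μ.map X) := Measure.isProbabilityMeasure_map hX.aemeasurable
  refine (ae_eq_condLExp hX.comap_le μ (fun ω => f (Y ω))
    (hf.lintegral_kernel.comp (comap_measurable X)) ?_).symm
  rintro _ ⟨t, ht, rfl⟩
  have h1 := Measure.setLIntegral_compProd (μ := μ.map X) (κ := κ) (f := fun z => f z.2)
    (by fun_prop) ht MeasurableSet.univ
  rw [← h, setLIntegral_map (ht.prod MeasurableSet.univ) (by fun_prop) (hX.prodMk hY),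
    setLIntegral_map ht (by simpa using hf.lintegral_kernel) hX] at h1
  simp only [Measure.restrict_univ] at h1
  refine h1.symm.trans ?_
  rw [Set.mk_preimage_prod, Set.preimage_univ, Set.inter_univ]

/-- Uniqueness of disintegration identifies `κ` with `condDistrib Y X μ` almost everywhere, so `κ`
inherits both the integrability and the integral formula. -/
theorem condExp_ae_eq_integral_of_map_eq_compProd {E : Type*} [MeasurableSpace E]
    [StandardBorelSpace E] [Nonempty E] (hX : Measurable X) {Y : Ω → E}
    (hY : Measurable Y) {κ : Kernel β E} [IsMarkovKernel κ]
    (h : μ.map (fun ω => (X ω, Y ω)) = μ.map X ⊗ₘ κ) {f : E → ℝ} (hf : Measurable f)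
    (hfi : Integrable (fun ω => f (Y ω)) μ) :
    ∀ᵐ ω ∂μ, Integrable f (κ (X ω)) ∧
      (μ[fun ω => f (Y ω) | mβ.comap X]) ω = ∫ y, f y ∂(κ (X ω)) := by
  have hκ := ae_of_ae_map hX.aemeasurable
    (condDistrib_ae_eq_of_measure_eq_compProd_of_measurable hX hY h)
  have h1 := condExp_ae_eq_integral_condDistrib hX hY.aemeasurable hf.stronglyMeasurable hfi
  have h2 : Integrable (fun z : β × E => f z.2) (μ.map fun ω => (X ω, Y ω)) :=
    (integrable_map_measure (hf.comp measurable_snd).aestronglyMeasurable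
      (hX.prodMk hY).aemeasurable).2 hfi
  filter_upwards [hκ, h1, h2.condDistrib_ae hX.aemeasurable hY.aemeasurable] with ω e1 e2 e3
  rw [← e1]
  exact ⟨e3, e2⟩
end

-- From moment growth to exponential moments.

/-- Telescoping with the potential `T k = 2 / (r (1 + r √k))`, `r = √(1 - s)`, which satisfies `1 /
√(k + 1) + s T (k + 1) ≤ T k`. Thus `T k` dominates the weighted tail from `k`, and `T 0 = 2 / r`.
-/
theorem sum_pow_div_sqrt_le {s : ℝ} (hs0 : 0 ≤ s) (hs1 : s < 1) (n : ℕ) :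
    ∑ k ∈ Finset.range n, s ^ k / √((k : ℝ) + 1) ≤ 2 * (1 - s) ^ (-(1 / 2) : ℝ) := by
  set r := √(1 - s) with hr
  have hr0 : 0 < r := Real.sqrt_pos.2 (by linarith)
  have hrs : s = 1 - r ^ 2 := by rw [hr, Real.sq_sqrt (by linarith)]; ring
  have hstep : ∀ k : ℕ, 1 / √((k : ℝ) + 1) + s * (2 / (r * (1 + r * √((k : ℝ) + 1)))) ≤
      2 / (r * (1 + r * √(k : ℝ))) := by
    intro k
    set a := √(k : ℝ)
    set b := √((k : ℝ) + 1)
    have ha : 0 ≤ a := Real.sqrt_nonneg _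
    have hb : 0 < b := Real.sqrt_pos.2 (by positivity)
    have hab : b ^ 2 = a ^ 2 + 1 := by
      rw [Real.sq_sqrt (by positivity), Real.sq_sqrt (by positivity)]
    have hle : a ≤ b := Real.sqrt_le_sqrt (by linarith)
    have hkey : 1 + r * (a - b) - r ^ 2 * (a * b) + 2 * (a * b) ≤ 2 * b ^ 2 := by
      have h1 : 0 ≤ r * (b - a) := mul_nonneg hr0.le (by linarith)
      have h2 : 0 ≤ r ^ 2 * (a * b) := by positivity
      nlinarith [sq_nonneg (b - a)]
    rw [hrs, div_add' _ _ _ hb.ne', ← mul_div_assoc, ← sub_nonneg]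
    have : 2 / (r * (1 + r * a)) - (1 + (1 - r ^ 2) * 2 / (r * (1 + r * b)) * b) / b =
        (2 * b ^ 2 - (1 + r * (a - b) - r ^ 2 * (a * b) + 2 * (a * b))) /
          (b * (1 + r * a) * (1 + r * b)) := by
      field_simp
      ring
    rw [this]
    exact div_nonneg (by linarith) (by positivity)
  have hsum : ∀ n : ℕ, ∑ k ∈ Finset.range n, s ^ k / √((k : ℝ) + 1) +
      s ^ n * (2 / (r * (1 + r * √(n : ℝ)))) ≤ 2 / r := by
    intro n
    induction n with
    | zero => simp
    | succ n ih =>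
      rw [Finset.sum_range_succ]
      refine le_trans ?_ ih
      have := mul_le_mul_of_nonneg_left (hstep n) (pow_nonneg hs0 n)
      push_cast
      rw [pow_succ]
      rw [mul_add, mul_one_div] at this
      linarith
  have hpos : 0 ≤ s ^ n * (2 / (r * (1 + r * √(n : ℝ)))) := by positivity
  have hfin : (1 - s) ^ (-(1 / 2) : ℝ) = 1 / r := by
    rw [Real.rpow_neg (by linarith), ← Real.sqrt_eq_rpow, one_div]
  rw [hfin, mul_one_div]
  linarith [hsum n]

theorem lintegral_enorm_rpow_le_of_lpNormSq_le {X : Type*} {mX : MeasurableSpace X} {p : ℝ}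
    (hp : 0 < p) {μ : Measure X} {u : X → ℝ} {B : ℝ} (hB : 0 ≤ B)
    (h : lpNormSq p μ u ≤ ENNReal.ofReal B) :
    ∫⁻ x, ‖u x‖ₑ ^ p ∂μ ≤ ENNReal.ofReal (B ^ (p / 2)) := by
  have h1 := ENNReal.rpow_le_rpow h (show 0 ≤ p / 2 by positivity)
  rwa [lpNormSq, ← ENNReal.rpow_mul, show 2 / p * (p / 2) = 1 by field_simp, ENNReal.rpow_one,
    ENNReal.ofReal_rpow_of_nonneg hB (by positivity)] at h1

theorem lpNormSq_le_of_exponent_le {X : Type*} {mX : MeasurableSpace X} {p q : ℝ}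
    (hp : 0 < p) (hpq : p ≤ q) (μ : Measure X) [IsProbabilityMeasure μ] {u : X → ℝ}
    (hu : Measurable u) : lpNormSq p μ u ≤ lpNormSq q μ u := by
  have hq : 0 < q := hp.trans_le hpq
  have h := eLpNorm'_le_eLpNorm'_of_exponent_le hp hpq μ hu.aestronglyMeasurable
  simp only [eLpNorm'] at h
  have h1 := ENNReal.rpow_le_rpow h zero_le_two
  rwa [← ENNReal.rpow_mul, ← ENNReal.rpow_mul, one_div_mul_eq_div, one_div_mul_eq_div] at h1

/-- The constant of the exponential moment bound. -/
noncomputable def expMomentConst (α : ℝ) : ℝ := 2 * (1 + Real.exp (2 / α) * √(2 / α))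

/-- The threshold is chosen so that `t₀ ^ k (α k) ^ k γ ^ (α k) = (k / e) ^ k`, which Stirling's
lower bound for `k!` absorbs with a factor `√k` to spare. -/
theorem pow_mul_rpow_div_factorial_le_of_le {α γ s : ℝ} (hα : 0 < α) (hγ : 0 < γ) (hs : 0 ≤ s)
    {k : ℕ} (hk : 1 ≤ k) :
    (s * expThreshold α γ) ^ k * ((α * k) ^ k * γ ^ (α * k)) / k.factorial ≤ s ^ k / √(k : ℝ) := by
  have hk0 : (0 : ℝ) < k := by exact_mod_cast hk
  have hst := Stirling.le_factorial_stirling k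
  have hsq : √(k : ℝ) ≤ √(2 * Real.pi * k) :=
    Real.sqrt_le_sqrt (by nlinarith [Real.pi_gt_three])
  have h1 : √(k : ℝ) * (k / Real.exp 1) ^ k ≤ k.factorial :=
    (mul_le_mul_of_nonneg_right hsq (by positivity)).trans hst
  have hsk : 0 < √(k : ℝ) := Real.sqrt_pos.2 hk0
  have hγα : 0 < γ ^ α := Real.rpow_pos_of_pos hγ _
  have e : (s * expThreshold α γ) ^ k * ((α * k) ^ k * γ ^ (α * k)) =
      s ^ k * (k / Real.exp 1) ^ k := by
    rw [Real.rpow_mul hγ.le, Real.rpow_natCast, ← mul_pow, ← mul_pow, ← mul_pow, expThreshold]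
    congr 1
    field_simp
  rw [e, div_le_div_iff₀ (by positivity) hsk, mul_assoc]
  refine mul_le_mul_of_nonneg_left ?_ (by positivity)
  rwa [mul_comm]

/-- Serves the finitely many terms whose exponent `α k` is below `2`, where only the second moment
is available. There `x ^ k / k! ≤ exp x` suffices, and `√(2 / α) / √k ≥ 1` supplies the missing `1 /
√k`. -/
theorem pow_mul_rpow_div_factorial_le_of_lt {α ν γ s : ℝ} (hν : 0 ≤ ν) (hα : α = 2 / (1 + 2 * ν))
    (hγ : 0 < γ) (hs : 0 ≤ s) {k : ℕ} (hk : 1 ≤ k) (hk2 : α * k < 2) :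
    (s * expThreshold α γ) ^ k * (2 ^ ν * γ) ^ (α * k) / k.factorial ≤
      Real.exp (2 / α) * √(2 / α) * (s ^ k / √(k : ℝ)) := by
  have hα0 : 0 < α := by rw [hα]; positivity
  have hk0 : (0 : ℝ) < k := by exact_mod_cast hk
  have hsk : 0 < √(k : ℝ) := Real.sqrt_pos.2 hk0
  have hγα : 0 < γ ^ α := Real.rpow_pos_of_pos hγ _
  have hνα : ν * α ≤ 1 := by
    rw [hα, ← mul_div_assoc, div_le_one (by positivity)]; linarith
  have h2 : (2 : ℝ) ^ (ν * α) ≤ 2 := by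
    calc (2 : ℝ) ^ (ν * α) ≤ 2 ^ (1 : ℝ) := Real.rpow_le_rpow_of_exponent_le (by norm_num) hνα
      _ = 2 := Real.rpow_one 2
  have he : 1 ≤ Real.exp 1 := Real.one_le_exp zero_le_one
  have e : (s * expThreshold α γ) ^ k * (2 ^ ν * γ) ^ (α * k) =
      s ^ k * (2 ^ (ν * α) / (Real.exp 1 * α)) ^ k := by
    rw [Real.rpow_mul (by positivity), Real.rpow_natCast, ← mul_pow, ← mul_pow, expThreshold,
      Real.mul_rpow (by positivity) hγ.le, ← Real.rpow_mul zero_le_two]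
    congr 1
    field_simp
  have hbase : 2 ^ (ν * α) / (Real.exp 1 * α) ≤ 2 / α := by
    rw [div_le_div_iff₀ (by positivity) hα0]
    nlinarith [mul_le_mul h2 (le_mul_of_one_le_left hα0.le he) hα0.le zero_le_two]
  have hexp : (2 ^ (ν * α) / (Real.exp 1 * α)) ^ k / k.factorial ≤ Real.exp (2 / α) :=
    (div_le_div_of_nonneg_right (pow_le_pow_left₀ (by positivity) hbase k) (by positivity)).trans
      (Real.pow_div_factorial_le_exp _ (by positivity) k)
  have hone : 1 ≤ √(2 / α) / √(k : ℝ) := by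
    rw [one_le_div hsk]
    refine Real.sqrt_le_sqrt ?_
    rw [le_div_iff₀ hα0]; linarith
  rw [e, mul_div_assoc]
  calc s ^ k * ((2 ^ (ν * α) / (Real.exp 1 * α)) ^ k / k.factorial)
      ≤ s ^ k * (Real.exp (2 / α) * (√(2 / α) / √(k : ℝ))) := by
        refine mul_le_mul_of_nonneg_left ?_ (by positivity)
        exact hexp.trans (le_mul_of_one_le_right (Real.exp_pos _).le hone)
    _ = _ := by ring

/-- Moment bounds of Weibull type control the conditional expectation of `exp (t |Z| ^ α)`. -/
theorem lintegral_exp_mul_abs_rpow_le {X : Type*} {mX : MeasurableSpace X} (μ : Measure X)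
    [IsProbabilityMeasure μ] {Z : X → ℝ} (hZ : Measurable Z) {α ν γ : ℝ} (hν : 0 ≤ ν)
    (hα : α = 2 / (1 + 2 * ν)) (hγ : 0 < γ)
    (hmom2 : lpNormSq 2 μ Z ≤ ENNReal.ofReal ((2 - 1) * (2 ^ ν * γ) ^ 2))
    (hmom : ∀ k : ℕ, 2 ≤ α * k → lpNormSq (α * k) μ Z ≤
      ENNReal.ofReal ((α * k - 1) * ((α * k) ^ ν * γ) ^ 2))
    {s : ℝ} (hs0 : 0 ≤ s) (hs1 : s < 1) :
    ∫⁻ x, ENNReal.ofReal (Real.exp (s * expThreshold α γ * |Z x| ^ α)) ∂μ ≤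
      ENNReal.ofReal (1 + expMomentConst α * (1 - s) ^ (-(1 / 2) : ℝ) * s) := by
  have hα0 : 0 < α := by rw [hα]; positivity
  have hT : 0 ≤ expThreshold α γ := by unfold expThreshold; positivity
  -- `1` covers the terms with `α k ≥ 2`, the other summand those with `α k < 2`; the remaining
  -- factor `2` of `expMomentConst` comes from the series bound.
  set A := 1 + Real.exp (2 / α) * √(2 / α) with hA
  have hA0 : 0 ≤ A := by positivity
  set t := s * expThreshold α γ with ht
  have ht0 : 0 ≤ t := mul_nonneg hs0 hT
  have hterm : ∀ k : ℕ, 1 ≤ k →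
      ∫⁻ x, ENNReal.ofReal ((t * |Z x| ^ α) ^ k / k.factorial) ∂μ ≤
        ENNReal.ofReal (A * (s ^ k / √(k : ℝ))) := by
    intro k hk
    have hk0 : (0 : ℝ) < k := by exact_mod_cast hk
    have hp0 : 0 < α * k := by positivity
    have e : ∀ x, ENNReal.ofReal ((t * |Z x| ^ α) ^ k / k.factorial) =
        ENNReal.ofReal (t ^ k / k.factorial) * ‖Z x‖ₑ ^ (α * k) := fun x => by
      rw [← ofReal_norm, Real.norm_eq_abs, ENNReal.ofReal_rpow_of_nonneg (abs_nonneg _) hp0.le,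
        ← ENNReal.ofReal_mul (by positivity), Real.rpow_mul (abs_nonneg _), Real.rpow_natCast]
      congr 1; ring
    simp only [e]
    rw [lintegral_const_mul _ (by fun_prop)]
    rcases le_or_gt 2 (α * k) with h2 | h2
    · have hb := lintegral_enorm_rpow_le_of_lpNormSq_le hp0
        (mul_nonneg (by linarith) (sq_nonneg _)) (hmom k h2)
      refine (mul_le_mul_right hb _).trans ?_
      rw [← ENNReal.ofReal_mul (by positivity)]
      refine ENNReal.ofReal_le_ofReal ?_
      have hbound : ((α * k - 1) * ((α * k) ^ ν * γ) ^ 2) ^ (α * k / 2) ≤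
          (α * k) ^ k * γ ^ (α * k) := by
        have h3 : (α * k - 1) * ((α * k) ^ ν * γ) ^ 2 ≤ (α * k) * ((α * k) ^ ν * γ) ^ 2 :=
          mul_le_mul_of_nonneg_right (by linarith) (sq_nonneg _)
        refine (Real.rpow_le_rpow (mul_nonneg (by linarith) (sq_nonneg _)) h3
          (by positivity)).trans (le_of_eq ?_)
        -- Here `α` is forced: the exponent `(1 + 2 ν) (α k / 2)` has to equal `k`.
        have h4 : (α * k) * ((α * k) ^ ν * γ) ^ 2 = (α * k) ^ (1 + 2 * ν) * γ ^ 2 := by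
          rw [Real.rpow_add hp0, Real.rpow_one, mul_pow, mul_comm 2 ν, Real.rpow_mul hp0.le,
            Real.rpow_two]
          ring
        rw [h4, Real.mul_rpow (by positivity) (by positivity), ← Real.rpow_mul hp0.le,
          ← Real.rpow_natCast γ 2, ← Real.rpow_mul hγ.le, ← Real.rpow_natCast (α * k) k]
        congr 2
        · rw [hα]; field_simp
        · push_cast; ring
      have h5 := pow_mul_rpow_div_factorial_le_of_le hα0 hγ hs0 hk
      calc t ^ k / k.factorial * ((α * k - 1) * ((α * k) ^ ν * γ) ^ 2) ^ (α * k / 2)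
          ≤ t ^ k / k.factorial * ((α * k) ^ k * γ ^ (α * k)) :=
            mul_le_mul_of_nonneg_left hbound (by positivity)
        _ = t ^ k * ((α * k) ^ k * γ ^ (α * k)) / k.factorial := by ring
        _ ≤ s ^ k / √(k : ℝ) := h5
        _ ≤ A * (s ^ k / √(k : ℝ)) :=
            le_mul_of_one_le_left (by positivity) (le_add_of_nonneg_right (by positivity))
    · have hb := lintegral_enorm_rpow_le_of_lpNormSq_le hp0 (by positivity)
        ((lpNormSq_le_of_exponent_le hp0 h2.le μ hZ).trans hmom2)
      refine (mul_le_mul_right hb _).trans ?_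
      rw [← ENNReal.ofReal_mul (by positivity)]
      refine ENNReal.ofReal_le_ofReal ?_
      have h4 : ((2 - 1) * ((2 : ℝ) ^ ν * γ) ^ 2) ^ (α * k / 2) = (2 ^ ν * γ) ^ (α * k) := by
        rw [← Real.rpow_natCast, show (2 : ℝ) - 1 = 1 by norm_num, one_mul,
          ← Real.rpow_mul (by positivity)]
        congr 1; push_cast; ring
      have h5 := pow_mul_rpow_div_factorial_le_of_lt hν hα hγ hs0 hk h2
      rw [h4]
      calc t ^ k / k.factorial * (2 ^ ν * γ) ^ (α * k)
          = t ^ k * (2 ^ ν * γ) ^ (α * k) / k.factorial := by ring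
        _ ≤ Real.exp (2 / α) * √(2 / α) * (s ^ k / √(k : ℝ)) := h5
        _ ≤ A * (s ^ k / √(k : ℝ)) :=
            mul_le_mul_of_nonneg_right (by rw [hA]; linarith) (by positivity)
  have hexp : ∀ x, ENNReal.ofReal (Real.exp (t * |Z x| ^ α)) =
      ∑' k : ℕ, ENNReal.ofReal ((t * |Z x| ^ α) ^ k / k.factorial) := fun x => by
    rw [Real.exp_eq_exp_ℝ, NormedSpace.exp_eq_tsum_div]
    exact ENNReal.ofReal_tsum_of_nonneg (fun k => by positivity)
      (Real.summable_pow_div_factorial _)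
  simp only [hexp]
  rw [lintegral_tsum fun k => by fun_prop]
  refine ENNReal.tsum_le_of_sum_range_le fun n => ?_
  -- One more term is added so that the term `k = 0`, which contributes the leading `1`, can be
  -- split off for every `n`.
  refine (Finset.sum_le_sum_of_subset (Finset.range_subset_range.2 n.le_succ)).trans ?_
  rw [Finset.sum_range_succ', add_comm]
  have h1s : 0 ≤ (1 - s) ^ (-(1 / 2) : ℝ) := Real.rpow_nonneg (by linarith) _
  have hc : 0 ≤ expMomentConst α := by unfold expMomentConst; positivity
  rw [ENNReal.ofReal_add zero_le_one (by positivity)]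
  refine add_le_add (by simp) ?_
  calc ∑ k ∈ Finset.range n, ∫⁻ x, ENNReal.ofReal ((t * |Z x| ^ α) ^ (k + 1) /
        (k + 1).factorial) ∂μ
      ≤ ∑ k ∈ Finset.range n, ENNReal.ofReal (A * (s ^ (k + 1) / √((k + 1 : ℕ) : ℝ))) :=
        Finset.sum_le_sum fun k _ => hterm (k + 1) (Nat.le_add_left 1 k)
    _ = ENNReal.ofReal (∑ k ∈ Finset.range n, A * (s ^ (k + 1) / √((k + 1 : ℕ) : ℝ))) :=
        (ENNReal.ofReal_sum_of_nonneg fun k _ => by positivity).symm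
    _ ≤ _ := by
        refine ENNReal.ofReal_le_ofReal ?_
        have e : ∑ k ∈ Finset.range n, A * (s ^ (k + 1) / √((k + 1 : ℕ) : ℝ)) =
            A * s * ∑ k ∈ Finset.range n, s ^ k / √((k : ℝ) + 1) := by
          rw [Finset.mul_sum]
          refine Finset.sum_congr rfl fun k _ => ?_
          push_cast; ring
        rw [e]
        refine (mul_le_mul_of_nonneg_left (sum_pow_div_sqrt_le hs0 hs1 n)
          (by positivity)).trans (le_of_eq ?_)
        rw [expMomentConst, ← hA]; ring

-- Conditional moments of the normalized sum.

theorem lpNormSq_sum_le {X ι : Type*} {mX : MeasurableSpace X} {p : ℝ} (hp : 1 ≤ p)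
    (μ : Measure X) (s : Finset ι) {u : ι → X → ℝ} (hu : ∀ j, Measurable (u j)) :
    lpNormSq p μ (fun x => ∑ j ∈ s, u j x) ≤
      (∑ j ∈ s, (∫⁻ x, ‖u j x‖ₑ ^ p ∂μ) ^ (1 / p)) ^ (2 : ℝ) := by
  have h := eLpNorm'_sum_le (μ := μ) (s := s) (fun j _ => (hu j).aestronglyMeasurable) hp
  simp only [eLpNorm', Finset.sum_apply] at h
  have h1 := ENNReal.rpow_le_rpow h zero_le_two
  rwa [← ENNReal.rpow_mul, one_div_mul_eq_div] at h1

section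
variable {Ω β E : Type*} {mΩ : MeasurableSpace Ω} [mβ : MeasurableSpace β] {μ : Measure Ω}
  [IsProbabilityMeasure μ] {X : Ω → β} [MeasurableSpace E] [StandardBorelSpace E] [Nonempty E]
  {n : ℕ} {e e' : Fin n → Ω → E} {F : Fin n → (Fin n → E) → ℝ}

/-- The conditional law given `X` of independent members, as a product measure. -/
noncomputable def condPiLaw (μ : Measure Ω) [IsProbabilityMeasure μ] (X : Ω → β)
    (e : Fin n → Ω → E) (ω : Ω) : Measure (Fin n → E) :=
  Measure.pi fun i => condDistrib (e i) X μ (X ω)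

instance isProbabilityMeasure_condPiLaw (ω : Ω) : IsProbabilityMeasure (condPiLaw μ X e ω) := by
  unfold condPiLaw; infer_instance

theorem map_prodMk_eq_compProd_condDistrib (hX : Measurable X) (he : ∀ i, Measurable (e i))
    (hind : CondIndepFamily (mβ.comap X) μ e) :
    μ.map (fun ω => (X ω, fun i => e i ω)) =
      μ.map X ⊗ₘ piKernel fun i => condDistrib (e i) X μ :=
  map_prodMk_eq_compProd_piKernel hX he hind _ fun i _ hB =>
    (condDistrib_ae_eq_condExp hX (he i) hB).symm

/-- Given `X`, the family `e` together with `e' i` has a product law in which `e' i` carries the law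
of `e i`, so replacing `e i` by its copy is resampling under the product measure. -/
theorem fdm_ae_eq (hX : Measurable X) (he : ∀ i, Measurable (e i)) (he' : ∀ i, Measurable (e' i))
    (hcopy : IsCondIndepCopy (mβ.comap X) μ e e') (hF : ∀ j, Measurable (F j)) (p : ℝ)
    (j i : Fin n) :
    ∀ᵐ ω ∂μ, fdm (mβ.comap X) μ F e e' p j i ω =
      (∫⁻ z, ‖F j z.1 - F j (Function.update z.1 i z.2)‖ₑ ^ p
        ∂((condPiLaw μ X e ω).prod (condDistrib (e i) X μ (X ω)))) ^ (1 / p) := by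
  obtain ⟨hid, hind⟩ := hcopy i
  let κ : Option (Fin n) → Kernel β E :=
    fun o => o.elim (condDistrib (e i) X μ) fun k => condDistrib (e k) X μ
  have hmarkov : ∀ o, IsMarkovKernel (κ o) := by
    rintro (_ | k)
    · exact inferInstanceAs (IsMarkovKernel (condDistrib (e i) X μ))
    · exact inferInstanceAs (IsMarkovKernel (condDistrib (e k) X μ))
  have hmeas : ∀ o : Option (Fin n), Measurable (o.elim (e' i) e) := by
    rintro (_ | k)
    · exact he' i
    · exact he k
  have hjoint := map_prodMk_eq_compProd_piKernel hX hmeas hind κ (by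
    rintro (_ | k) B hB
    · exact (hid B hB).trans (condDistrib_ae_eq_condExp hX (he i) hB).symm
    · exact (condDistrib_ae_eq_condExp hX (he k) hB).symm)
  have hupd : Measurable fun z : (Fin n → E) × E => Function.update z.1 i z.2 := by
    refine measurable_pi_lambda _ fun k => ?_
    by_cases h : k = i
    · subst h; simpa using measurable_snd
    · simp only [Function.update_of_ne h]; fun_prop
  have hsplit : Measurable fun w : Option (Fin n) → E => ((fun k => w (some k)), w none) :=
    (measurable_pi_lambda _ fun k => measurable_pi_apply _).prodMk (measurable_pi_apply _)
  have hD : Measurable fun z : (Fin n → E) × E =>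
      ‖F j z.1 - F j (Function.update z.1 i z.2)‖ₑ ^ p :=
    (((hF j).comp measurable_fst).sub ((hF j).comp hupd)).enorm.pow_const p
  have h := condLExp_ae_eq_lintegral hX (measurable_pi_lambda _ hmeas) hjoint (hD.comp hsplit)
  filter_upwards [h] with ω hω
  have hpres := measurePreserving_optionElim fun o => κ o (X ω)
  rw [fdm, condLpNorm]
  refine congrArg (fun y : ℝ≥0∞ => y ^ (1 / p)) (Eq.trans hω ?_)
  rw [piKernel_apply, ← hpres.lintegral_comp (hD.comp hsplit)]
  rfl

theorem ae_sum_resampleSq_le (hX : Measurable X) (he : ∀ i, Measurable (e i))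
    (he' : ∀ i, Measurable (e' i)) (hcopy : IsCondIndepCopy (mβ.comap X) μ e e')
    (hF : ∀ j, Measurable (F j)) {p : ℝ} (hp : 1 ≤ p) :
    ∀ᵐ ω ∂μ, ∑ i, resampleSq p (fun i => condDistrib (e i) X μ (X ω)) (fun x => ∑ j, F j x) i ≤
      ∑ i, (∑ j, fdm (mβ.comap X) μ F e e' p j i ω) ^ (2 : ℝ) := by
  have h : ∀ᵐ ω ∂μ, ∀ j i, fdm (mβ.comap X) μ F e e' p j i ω =
      (∫⁻ z, ‖F j z.1 - F j (Function.update z.1 i z.2)‖ₑ ^ p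
        ∂((condPiLaw μ X e ω).prod (condDistrib (e i) X μ (X ω)))) ^ (1 / p) :=
    ae_all_iff.2 fun j => ae_all_iff.2 fun i => fdm_ae_eq hX he he' hcopy hF p j i
  filter_upwards [h] with ω hω
  refine Finset.sum_le_sum fun i _ => ?_
  simp only [hω, resampleSq, ← Finset.sum_sub_distrib]
  exact lpNormSq_sum_le hp _ _ fun j => ((hF j).comp measurable_fst).sub ((hF j).comp
    (measurePreserving_update (fun i => condDistrib (e i) X μ (X ω)) i).measurable)

/-- The dependence hypothesis squared: the normalization `n · n⁻²` leaves exactly the `1 / n` coming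
from the square of `n ^ (-1 / 2)` in `Z`. -/
theorem ofReal_mul_le_of_fdmDelta_le (hn : 1 ≤ n) {p ν γ : ℝ} (hp : 0 < p) (hγ : 0 ≤ γ)
    {S : ℝ≥0∞} (h : ENNReal.ofReal (p ^ (-ν) * √(n : ℝ)) * (S / (n : ℝ≥0∞) ^ (2 : ℝ)) ^ (1 / 2 : ℝ) ≤
      ENNReal.ofReal γ) :
    ENNReal.ofReal ((1 / √(n : ℝ)) ^ 2) * S ≤ ENNReal.ofReal ((p ^ ν * γ) ^ 2) := by
  have hn0 : (0 : ℝ) < n := by exact_mod_cast hn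
  have h1 := ENNReal.rpow_le_rpow h zero_le_two
  have hdiv : S / (n : ℝ≥0∞) ^ (2 : ℝ) = ENNReal.ofReal (((n : ℝ) ^ 2)⁻¹) * S := by
    rw [div_eq_mul_inv, mul_comm, ENNReal.ofReal_inv_of_pos (by positivity),
      ENNReal.ofReal_pow hn0.le, ENNReal.ofReal_natCast, ENNReal.rpow_two]
  rw [ENNReal.mul_rpow_of_nonneg _ _ zero_le_two, ← ENNReal.rpow_mul,
    one_div_mul_cancel two_ne_zero, ENNReal.rpow_one, hdiv, ENNReal.rpow_two, ENNReal.rpow_two,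
    ← ENNReal.ofReal_pow (by positivity), ← ENNReal.ofReal_pow hγ, ← mul_assoc,
    ← ENNReal.ofReal_mul (by positivity)] at h1
  have h2 := mul_le_mul_right h1 (ENNReal.ofReal ((p ^ ν) ^ 2))
  rw [← mul_assoc, ← ENNReal.ofReal_mul (by positivity), ← ENNReal.ofReal_mul (by positivity),
    ← mul_pow] at h2
  refine le_of_eq_of_le ?_ h2
  congr 2
  have hpν : p ^ ν ≠ 0 := (Real.rpow_pos_of_pos hp ν).ne'
  rw [mul_pow, div_pow, Real.sq_sqrt hn0.le, Real.rpow_neg hp.le]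
  field_simp

/-- Efron–Stein is applied for almost every fixed `ω` to `∑ j, F j` under `condPiLaw`; conditional
centring makes the subtracted mean vanish. -/
theorem ae_lpNormSq_condPiLaw_le (hX : Measurable X) (he : ∀ i, Measurable (e i))
    (he' : ∀ i, Measurable (e' i)) (hind : CondIndepFamily (mβ.comap X) μ e)
    (hcopy : IsCondIndepCopy (mβ.comap X) μ e e')
    (hF : ∀ j, Measurable (F j)) (hint : ∀ j, Integrable (networkVar F e j) μ)
    (hcent : ∀ j, μ[networkVar F e j | mβ.comap X] =ᵐ[μ] 0) (hn : 1 ≤ n) {p ν γ : ℝ} (hp : 2 ≤ p)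
    (hγ : 0 ≤ γ)
    (hbound : ∀ᵐ ω ∂μ, ENNReal.ofReal (p ^ (-ν) * √(n : ℝ)) *
      fdmDelta (mβ.comap X) μ F e e' p 2 ω ^ (1 / 2 : ℝ) ≤ ENNReal.ofReal γ) :
    ∀ᵐ ω ∂μ, lpNormSq p (condPiLaw μ X e ω) (fun x => (∑ j, F j x) / √(n : ℝ)) ≤
      ENNReal.ofReal ((p - 1) * (p ^ ν * γ) ^ 2) := by
  have hlaw : ∀ᵐ ω ∂μ, ∀ j, Integrable (F j) (condPiLaw μ X e ω) ∧
      (μ[networkVar F e j | mβ.comap X]) ω = ∫ y, F j y ∂(condPiLaw μ X e ω) :=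
    ae_all_iff.2 fun j => condExp_ae_eq_integral_of_map_eq_compProd hX
      (measurable_pi_lambda _ he) (map_prodMk_eq_compProd_condDistrib hX he hind) (hF j) (hint j)
  filter_upwards [hlaw, ae_all_iff.2 hcent, hbound,
    ae_sum_resampleSq_le hX he he' hcopy hF (p := p) (by linarith)] with ω h1 h2 h3 h4
  have hGm : Measurable fun x => ∑ j, F j x := Finset.measurable_fun_sum _ fun j _ => hF j
  have hGi : Integrable (fun x => ∑ j, F j x) (condPiLaw μ X e ω) :=
    integrable_finsetSum _ fun j _ => (h1 j).1
  have hG0 : ∫ x, ∑ j, F j x ∂(condPiLaw μ X e ω) = 0 := by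
    rw [integral_finsetSum _ fun j _ => (h1 j).1]
    exact Finset.sum_eq_zero fun j _ => by rw [← (h1 j).2, h2 j, Pi.zero_apply]
  have hES := lpNormSq_sub_integral_le_sum_resampleSq hp
    (fun i => condDistrib (e i) X μ (X ω)) hGm hGi
  change lpNormSq p (condPiLaw μ X e ω)
    (fun x => ∑ j, F j x - ∫ x, ∑ j, F j x ∂(condPiLaw μ X e ω)) ≤ _ at hES
  rw [hG0] at hES
  simp only [sub_zero] at hES
  have hscale : (fun x => (∑ j, F j x) / √(n : ℝ)) = fun x => (1 / √(n : ℝ)) * ∑ j, F j x := by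
    ext x; ring
  rw [hscale, lpNormSq_const_mul (by linarith), ENNReal.ofReal_mul (by linarith)]
  calc ENNReal.ofReal ((1 / √(n : ℝ)) ^ 2) * lpNormSq p (condPiLaw μ X e ω) (fun x => ∑ j, F j x)
      ≤ ENNReal.ofReal ((1 / √(n : ℝ)) ^ 2) * (ENNReal.ofReal (p - 1) *
          ∑ i, (∑ j, fdm (mβ.comap X) μ F e e' p j i ω) ^ (2 : ℝ)) :=
        mul_le_mul_right (hES.trans (mul_le_mul_right h4 _)) _
    _ = ENNReal.ofReal (p - 1) * (ENNReal.ofReal ((1 / √(n : ℝ)) ^ 2) *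
          ∑ i, (∑ j, fdm (mβ.comap X) μ F e e' p j i ω) ^ (2 : ℝ)) := by ring
    _ ≤ _ := mul_le_mul_right (ofReal_mul_le_of_fdmDelta_le hn (by linarith) hγ h3) _

/-- Conditional exponential moments of the normalized sum. -/
theorem integrable_exp_and_condExpMoment_le (hX : Measurable X) (he : ∀ i, Measurable (e i))
    (he' : ∀ i, Measurable (e' i)) (hind : CondIndepFamily (mβ.comap X) μ e)
    (hcopy : IsCondIndepCopy (mβ.comap X) μ e e')
    (hF : ∀ j, Measurable (F j)) (hint : ∀ j, Integrable (networkVar F e j) μ)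
    (hcent : ∀ j, μ[networkVar F e j | mβ.comap X] =ᵐ[μ] 0) (hn : 1 ≤ n) {ν γ α : ℝ}
    (hν : 0 ≤ ν) (hγ : 0 < γ) (hα : α = 2 / (1 + 2 * ν))
    (hbound : ∀ p : ℝ, 2 ≤ p → ∀ᵐ ω ∂μ, ENNReal.ofReal (p ^ (-ν) * √(n : ℝ)) *
      fdmDelta (mβ.comap X) μ F e e' p 2 ω ^ (1 / 2 : ℝ) ≤ ENNReal.ofReal γ)
    {s : ℝ} (hs0 : 0 ≤ s) (hs1 : s < 1) :
    Integrable (fun ω => Real.exp (s * expThreshold α γ * |normalizedSum F e ω| ^ α)) μ ∧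
      ∀ᵐ ω ∂μ, condExpMoment (mβ.comap X) μ α (normalizedSum F e) (s * expThreshold α γ) ω ≤
        1 + expMomentConst α * (1 - s) ^ (-(1 / 2) : ℝ) * s := by
  have hem : Measurable fun ω => fun i => e i ω := measurable_pi_lambda _ he
  have hZm : Measurable fun x => (∑ j, F j x) / √(n : ℝ) :=
    (Finset.measurable_fun_sum _ fun j _ => hF j).div_const _
  have hjoint := map_prodMk_eq_compProd_condDistrib hX he hind
  have hL := fun (p : ℝ) (hp : 2 ≤ p) =>
    ae_lpNormSq_condPiLaw_le hX he he' hind hcopy hF hint hcent hn hp hγ.le (hbound p hp)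
  -- The exceptional null set depends on `p`; only `p = 2` and the countably many `p = α k` are
  -- needed, so a common one exists.
  have hLk : ∀ᵐ ω ∂μ, ∀ k : ℕ, 2 ≤ α * k →
      lpNormSq (α * k) (condPiLaw μ X e ω) (fun x => (∑ j, F j x) / √(n : ℝ)) ≤
        ENNReal.ofReal ((α * k - 1) * ((α * k) ^ ν * γ) ^ 2) := by
    refine ae_all_iff.2 fun k => ?_
    by_cases hk : 2 ≤ α * k
    · filter_upwards [hL (α * k) hk] with ω hω _ using hω
    · exact Filter.Eventually.of_forall fun ω h => absurd h hk
  set B := 1 + expMomentConst α * (1 - s) ^ (-(1 / 2) : ℝ) * s with hB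
  set f : (Fin n → E) → ℝ :=
    fun x => Real.exp (s * expThreshold α γ * |(∑ j, F j x) / √(n : ℝ)| ^ α) with hf
  have hfm : Measurable f := by
    refine Real.measurable_exp.comp (Measurable.const_mul ?_ _)
    exact (measurable_norm.comp hZm).pow_const α
  have hle : ∀ᵐ ω ∂μ, ∫⁻ x, ENNReal.ofReal (f x) ∂(condPiLaw μ X e ω) ≤ ENNReal.ofReal B := by
    filter_upwards [hL 2 le_rfl, hLk] with ω h1 h2
    exact lintegral_exp_mul_abs_rpow_le _ hZm hν hα hγ h1 h2 hs0 hs1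
  have hB0 : 0 ≤ B := by
    have : 0 ≤ (1 - s) ^ (-(1 / 2) : ℝ) := Real.rpow_nonneg (by linarith) _
    have : 0 ≤ expMomentConst α := by unfold expMomentConst; positivity
    positivity
  -- Integrating the almost sure bound on the conditional `lintegral`, which needs no prior
  -- integrability.
  have hfi : Integrable (fun ω => f (fun i => e i ω)) μ := by
    refine (lintegral_ofReal_ne_top_iff_integrable (hfm.comp hem).aestronglyMeasurable
      (Filter.Eventually.of_forall fun _ => (Real.exp_pos _).le)).1 ?_
    simp only [Function.comp_apply]
    rw [← lintegral_condLExp hX.comap_le,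
      lintegral_congr_ae (condLExp_ae_eq_lintegral hX hem hjoint hfm.ennreal_ofReal)]
    refine ne_top_of_le_ne_top (ENNReal.ofReal_ne_top (r := B)) ((lintegral_mono_ae hle).trans ?_)
    rw [lintegral_const, measure_univ, mul_one]
  refine ⟨hfi, ?_⟩
  filter_upwards [condExp_ae_eq_integral_of_map_eq_compProd hX hem hjoint hfm hfi, hle]
    with ω h1 h2
  refine (le_of_eq h1.2).trans ?_
  rw [integral_eq_lintegral_of_nonneg_ae (Filter.Eventually.of_forall fun _ => (Real.exp_pos _).le)
    hfm.aestronglyMeasurable]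
  exact ENNReal.toReal_le_of_le_ofReal hB0 h2
end

-- Tail bound and conclusion.

/-- The conditional Chernoff bound. -/
theorem condProb_le_exp_mul_condExpMoment {Ω : Type*} {m mΩ : MeasurableSpace Ω} {μ : Measure Ω}
    [IsProbabilityMeasure μ] {Z : Ω → ℝ} (hZ : Measurable Z) {α t x : ℝ} (hα : 0 ≤ α) (ht : 0 ≤ t)
    (hx : 0 ≤ x) (hi : Integrable (fun ω => Real.exp (t * |Z ω| ^ α)) μ) :
    ∀ᵐ ω ∂μ, (μ⟦{ω' | x ≤ |Z ω'|} | m⟧) ω ≤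
      Real.exp (-t * x ^ α) * condExpMoment m μ α Z t ω := by
  have hA : MeasurableSet {ω' | x ≤ |Z ω'|} := measurableSet_le measurable_const hZ.norm
  have hmono := condExp_mono (m := m) ((integrable_const (1 : ℝ)).indicator hA)
    (hi.smul (Real.exp (-t * x ^ α))) (Filter.Eventually.of_forall fun ω => by
      simp only [Pi.smul_apply, smul_eq_mul, ← Real.exp_add]
      refine Set.indicator_apply_le' (fun hω => Real.one_le_exp ?_) (fun _ => (Real.exp_pos _).le)
      have := mul_le_mul_of_nonneg_left (Real.rpow_le_rpow hx hω hα) ht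
      linarith)
  filter_upwards [hmono, condExp_smul (μ := μ) (Real.exp (-t * x ^ α))
    (fun ω => Real.exp (t * |Z ω| ^ α)) m] with ω h1 h2
  refine h1.trans (le_of_eq ?_)
  exact h2
theorem mainTheorem4 :
    ∃ c : ℝ → ℝ,
      ∀ {Ω : Type*} [mΩ : MeasurableSpace Ω] (μ : Measure Ω) [IsProbabilityMeasure μ]
        (d : ℕ) (C : ℕ → MeasurableSpace Ω) (_hC : ∀ n, C n ≤ mΩ)
        (e e' : (n : ℕ) → Fin n → Ω → EuclideanSpace ℝ (Fin d))
        (_he : ∀ n i, Measurable (e n i)) (_he' : ∀ n i, Measurable (e' n i))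
        (_hindep : ∀ n, CondIndepFamily (C n) μ (e n))
        (_hcopy : ∀ n, IsCondIndepCopy (C n) μ (e n) (e' n))
        (F : (n : ℕ) → Fin n → (Fin n → EuclideanSpace ℝ (Fin d)) → ℝ)
        (_hF : ∀ n j, Measurable (F n j))
        (_hint : ∀ n j, Integrable (networkVar (F n) (e n) j) μ)
        (_hcentered : ∀ n j, μ[networkVar (F n) (e n) j | C n] =ᵐ[μ] 0)
        (ν γ₀ α t₀ : ℝ) (_hν : 0 ≤ ν) (_hγ₀ : 0 < γ₀)
        (_hbound : ∀ p : ℝ, 2 ≤ p → ∀ n : ℕ, 1 ≤ n → ∀ᵐ ω ∂μ,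
          ENNReal.ofReal (p ^ (-ν) * √(n : ℝ)) *
            fdmDelta (C n) μ (F n) (e n) (e' n) p 2 ω ^ (1 / 2 : ℝ) ≤ ENNReal.ofReal γ₀)
        (_hα : α = 2 / (1 + 2 * ν)) (_ht₀ : t₀ = expThreshold α γ₀)
        (n : ℕ) (_hn : 1 ≤ n),
        (∀ t : ℝ, 0 ≤ t → t < t₀ →
          Integrable (fun ω => Real.exp (t * |normalizedSum (F n) (e n) ω| ^ α)) μ ∧
          ∀ᵐ ω ∂μ, condExpMoment (C n) μ α (normalizedSum (F n) (e n)) t ω ≤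
            1 + c α * (1 - t / t₀) ^ (-(1 / 2) : ℝ) * (t / t₀)) ∧
        (∀ x : ℝ, 0 < x → ∀ᵐ ω ∂μ,
          (μ⟦{ω' | x ≤ |normalizedSum (F n) (e n) ω'|} | C n⟧) ω ≤
              Real.exp (-(t₀ / 2) * x ^ α) *
                condExpMoment (C n) μ α (normalizedSum (F n) (e n)) (t₀ / 2) ω ∧
          Real.exp (-(t₀ / 2) * x ^ α) *
                condExpMoment (C n) μ α (normalizedSum (F n) (e n)) (t₀ / 2) ω ≤
            (1 + √2 * c α / 2) *
              Real.exp (-(x ^ α) / (2 * Real.exp 1 * α * γ₀ ^ α))) := by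
  refine ⟨expMomentConst, ?_⟩
  intro Ω mΩ μ _ d C hC e e' he he' hindep hcopy F hF hint hcent ν γ₀ α t₀ hν hγ hbound hα ht₀ n hn
  have hα0 : 0 < α := by rw [hα]; positivity
  have hpos : 0 < t₀ := by rw [ht₀]; unfold expThreshold; positivity
  have main : ∀ s : ℝ, 0 ≤ s → s < 1 →
      Integrable (fun ω => Real.exp (s * t₀ * |normalizedSum (F n) (e n) ω| ^ α)) μ ∧
        ∀ᵐ ω ∂μ, condExpMoment (C n) μ α (normalizedSum (F n) (e n)) (s * t₀) ω ≤
          1 + expMomentConst α * (1 - s) ^ (-(1 / 2) : ℝ) * s := by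
    intro s hs0 hs1
    -- The conditioning variable is the identity from `Ω` to `Ω` equipped with `C n`, whose comap is
    -- `C n` itself; an arbitrary sub-σ-field is thus covered without any condition on `Ω`.
    have h := @integrable_exp_and_condExpMoment_le Ω Ω (EuclideanSpace ℝ (Fin d)) mΩ (C n) μ _ id
      _ _ _ n (e n) (e' n) (F n) (measurable_id'' (hC n)) (he n) (he' n)
    rw [MeasurableSpace.comap_id] at h
    rw [ht₀]
    exact h (hindep n) (hcopy n) (hF n) (hint n) (hcent n) hn hν hγ hα
      (fun p hp => hbound p hp n hn) hs0 hs1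
  refine ⟨fun t ht0 ht => ?_, fun x hx => ?_⟩
  · have h := main (t / t₀) (div_nonneg ht0 hpos.le) ((div_lt_one hpos).2 ht)
    rwa [div_mul_cancel₀ _ hpos.ne'] at h
  -- At `s = 1 / 2` the moment bound is `1 + c · √2 · 1 / 2`.
  · have h := main (1 / 2) (by norm_num) (by norm_num)
    rw [one_div_mul_eq_div] at h
    have hZ : Measurable (normalizedSum (F n) (e n)) :=
      (Finset.measurable_fun_sum _ fun j _ =>
        (hF n j).comp (measurable_pi_lambda _ (he n))).div_const _
    filter_upwards [h.2, condProb_le_exp_mul_condExpMoment (m := C n) hZ hα0.le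
      (half_pos hpos).le hx.le h.1] with ω h1 h2
    refine ⟨h2, ?_⟩
    have hexp : -(t₀ / 2) * x ^ α = -(x ^ α) / (2 * Real.exp 1 * α * γ₀ ^ α) := by
      have : 0 < γ₀ ^ α := Real.rpow_pos_of_pos hγ _
      rw [ht₀, expThreshold]
      field_simp
    have hsqrt : (1 - 1 / 2 : ℝ) ^ (-(1 / 2) : ℝ) = √2 := by
      rw [Real.sqrt_eq_rpow, Real.rpow_neg (by norm_num), ← Real.inv_rpow (by norm_num)]
      norm_num
    rw [hexp, mul_comm]
    refine mul_le_mul_of_nonneg_right (h1.trans (le_of_eq ?_)) (Real.exp_pos _).le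
    rw [hsqrt]
    ring
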